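/- **Definitions.** A *set system* $D=(E,\mathcal F)$ is a finite set $E$ with a collection $\mathcal F$ of subsets of $E$ (the *feasible sets*). It is a *delta-matroid* if $\mathcal F\neq\emptyset$ and for all $X,Y\in\mathcal F$ and $u\in X\triangle Y$ there is $v\in X\triangle Y$ (possibly $v=u$) with $X\triangle\{u,v\}\in\mathcal F$. For a finite ribbon graph $G$ with edge set $E(G)$, $D(G)$ is the set system on $E(G)$ whose feasible sets are the edge sets $F$ of the spanning quasi-trees of $G$, i.e. those $F\subseteq E(G)$ such that inside each connected component of $G$ the spanning ribbon subgraph with edge set $F$ has exactly one boundary component. A delta-matroid is *ribbon graphic* if it is isomorphic to $D(G)$ for some ribbon graph $G$. For distinct $a,b\in E$, the *handle slide* of $a$ over $b$ takes $D$ to $D_{ab}=(E,\mathcal F_{ab})$, where $$\mathcal F_{ab}=\mathcal F\,\triangle\,\{X\cup\{a\} : X\subseteq E\setminus\{a,b\},\ X\cup\{b\}\in\mathcal F\}.$$ A *sequence of handle slides taking $D$ to $D'$* is a finite sequence $D=S_0,S_1,\dots,S_n=D'$ ($n\ge 0$) of set systems on $E$ in which each $S_{t+1}$ equals $(S_t)_{ab}$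 for some distinct $a,b\in E$. For integers $i,j,k\ge 0$, $D_{i,j,k}$ is (up to isomorphism) the direct sum of $i$ copies of $(\{e\},\{\emptyset\})$, $j$ copies of $(\{e,f\},\{\emptyset,\{e,f\}\})$ and $k$ copies of $(\{e\},\{\emptyset,\{e\}\})$. **Corollary.** Let $D=(E,\mathcal F)$ be a ribbon graphic delta-matroid in which the empty set is feasible, let $i,j,k\ge 0$ be integers, and let $D'$ be a set system on $E$ isomorphic to $D_{i,j,k}$. If there is a sequence of handle slides taking $D$ to $D'$, then there is a sequence of handle slides $D=S_0,S_1,\dots,S_n=D'$ taking $D$ to $D'$ in which every $S_t$, $0\le t\le n$, is a ribbon graphic delta-matroid. -/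

import Mathlib

open scoped symmDiff

/-! ### Set systems, delta-matroids and handle slides -/

/-- A set system whose ground set is the whole type `E` (finite where it is used). -/
@[ext] structure SetSystem (E : Type*) where
  /-- The collection of feasible sets. -/
  feasible : Set (Set E)

namespace SetSystem

/-- A delta-matroid is a set system with at least one feasible set that satisfies the symmetric
exchange axiom. (The case `v = u` is allowed, and then `X ∆ {u, v} = X ∆ {u}`.) -/
def IsDeltaMatroid {E : Type*} (D : SetSystem E) : Prop :=
  D.feasible.Nonempty ∧
    ∀ X ∈ D.feasible, ∀ Y ∈ D.feasible, ∀ u ∈ X ∆ Y, ∃ v ∈ X ∆ Y, X ∆ {u, v} ∈ D.feasible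

/-- Isomorphism of set systems: a bijection of the ground sets that preserves and reflects
feasibility. -/
def IsIsomorphic {E E' : Type*} (D : SetSystem E) (D' : SetSystem E') : Prop :=
  ∃ f : E ≃ E', ∀ X : Set E, X ∈ D.feasible ↔ f '' X ∈ D'.feasible

/-- The set system `D_{ab}`. -/
def handleSlide {E : Type*} (D : SetSystem E) (a b : E) : SetSystem E where
  feasible := D.feasible ∆
    {Y | ∃ X : Set E, a ∉ X ∧ b ∉ X ∧ insert b X ∈ D.feasible ∧ Y = insert a X}

/-- `S 0, S 1, …, S n` is a sequence of handle slides taking `D` to `D'`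
(the values of `S` beyond `n` play no role). -/
def IsHandleSlideSeq {E : Type*} (D D' : SetSystem E) (n : ℕ) (S : ℕ → SetSystem E) : Prop :=
  S 0 = D ∧ S n = D' ∧ ∀ t < n, ∃ a b : E, a ≠ b ∧ S (t + 1) = (S t).handleSlide a b

/-- The direct sum, on the disjoint union of the two ground sets: the feasible sets are the
disjoint unions of a feasible set of `D` and a feasible set of `D'`. -/
def directSum {E E' : Type*} (D : SetSystem E) (D' : SetSystem E') : SetSystem (E ⊕ E') where
  feasible := {X | Sum.inl ⁻¹' X ∈ D.feasible ∧ Sum.inr ⁻¹' X ∈ D'.feasible}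

/-- The direct sum of `n` copies of `D`; the `t`-th copy has ground set `{t} × E`. -/
def copies {E : Type*} (n : ℕ) (D : SetSystem E) : SetSystem (Fin n × E) where
  feasible := {X | ∀ t : Fin n, {e | (t, e) ∈ X} ∈ D.feasible}

/-- The canonical form `D_{i,j,k}`: the direct sum of `i` copies of `({e}, {∅})`,
`j` copies of `({e,f}, {∅, {e,f}})` and `k` copies of `({e}, {∅, {e}})`. -/
def canonical (i j k : ℕ) : SetSystem ((Fin i × Unit) ⊕ ((Fin j × Bool) ⊕ (Fin k × Unit))) :=
  directSum (copies i ⟨{∅}⟩) (directSum (copies j ⟨{∅, Set.univ}⟩) (copies k ⟨{∅, Set.univ}⟩))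

end SetSystem

/-! ### Ribbon graphs -/

/-- A ribbon graph with vertex set `V` and edge set `E`, presented as a signed rotation system.
The edge `e` has the two ends `(e, false)` and `(e, true)`. An orientation of every vertex disc is
chosen; `rot` sends an end to the next one on the boundary of its vertex, so that the ends at a
vertex form one cycle of `rot`. An edge is in `twisted` if its ribbon is glued in with a half twist
with respect to the chosen orientations. Vertices without ends are allowed. -/
structure RibbonGraph (V E : Type*) where
  /-- The vertex at which an end of an edge is attached. -/
  vert : E × Bool → V
  /-- The next end around the vertex. -/
  rot : Equiv.Perm (E × Bool)
  sameCycle_iff : ∀ h h' : E × Bool, rot.SameCycle h h' ↔ vert h = vert h'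
  /-- The edges whose ribbon has a half twist. -/
  twisted : Set E

namespace RibbonGraph

variable {V E : Type*} (G : RibbonGraph V E)

/-- Two vertices lie in the same connected component. -/
def Connected : V → V → Prop :=
  Relation.EqvGen fun v w => ∃ e : E, G.vert (e, false) = v ∧ G.vert (e, true) = w

/-- Marked points that meet every boundary component of every spanning ribbon subgraph. Each end `h`
is attached to its vertex along a line segment, whose two end points are `(h, false)` (where the
segment starts, in the orientation of the vertex) and `(h, true)` (where it stops). In addition
there is one point on the boundary of each vertex without ends. -/
abbrev BoundaryPoint : Type _ := ((E × Bool) × Bool) ⊕ {v : V // ∀ h, G.vert h ≠ v}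

/-- The vertex on whose boundary a marked point lies. -/
def pointVert : G.BoundaryPoint → V
  | Sum.inl p => G.vert p.1
  | Sum.inr v => v.1

/-- The arcs between marked points that make up the boundary of the spanning ribbon subgraph
with edge set `A`. -/
inductive BoundaryArc (A : Set E) : G.BoundaryPoint → G.BoundaryPoint → Prop
  /-- The arc of a vertex boundary from one line segment to the next. -/
  | vertexArc (h : E × Bool) : BoundaryArc A (Sum.inl (h, true)) (Sum.inl (G.rot h, false))
  /-- If an edge is deleted, the segments where it was attached belong to the boundary. -/
  | segment (h : E × Bool) (hA : h.1 ∉ A) :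
      BoundaryArc A (Sum.inl (h, false)) (Sum.inl (h, true))
  /-- The two sides of an edge without a half twist. -/
  | side (e : E) (s : Bool) (hA : e ∈ A) (ht : e ∉ G.twisted) :
      BoundaryArc A (Sum.inl ((e, false), s)) (Sum.inl ((e, true), !s))
  /-- The two sides of an edge with a half twist. -/
  | twistedSide (e : E) (s : Bool) (hA : e ∈ A) (ht : e ∈ G.twisted) :
      BoundaryArc A (Sum.inl ((e, false), s)) (Sum.inl ((e, true), s))

/-- The boundary components of the spanning ribbon subgraph with edge set `A`. -/
def BoundaryComponent (A : Set E) : Type _ := Quot (G.BoundaryArc A)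

/-- `A` is the edge set of a spanning quasi-tree: inside every connected component of `G` (given by
one of its vertices `v`), the spanning ribbon subgraph with edge set `A` has exactly one boundary
component. -/
def IsSpanningQuasiTree (A : Set E) : Prop :=
  ∀ v : V, ∃! c : G.BoundaryComponent A,
    ∃ p : G.BoundaryPoint, Quot.mk _ p = c ∧ G.Connected v (G.pointVert p)

/-- The delta-matroid `D(G)` of a ribbon graph. -/
def deltaMatroid : SetSystem E where
  feasible := {A | G.IsSpanningQuasiTree A}

end RibbonGraph

/-- A delta-matroid is ribbon graphic if it is isomorphic to the delta-matroid of a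
(finite) ribbon graph. -/
def SetSystem.IsRibbonGraphic {E : Type*} (D : SetSystem E) : Prop :=
  D.IsDeltaMatroid ∧
    ∃ (V E' : Type) (_ : Finite V) (_ : Finite E') (G : RibbonGraph V E'),
      D.IsIsomorphic G.deltaMatroid

open scoped Matrix

/-! If the empty set is feasible for a ribbon graph, every edge is a loop, and the feasible sets
index the nonsingular principal submatrices of a symmetric matrix over the two-element field. Its
diagonal records the half twists; off the diagonal it records interlacement in a double occurrence
word listing the ends around the vertices (`RibbonGraph.exists_isGraphic`). Interlacement is a
parity: in a double occurrence word, the number of ordered pairs "e before f" is odd exactly when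
`e` and `f` alternate. Conversely, each such matrix, called graphic, comes from a one-vertex ribbon
graph (`IsGraphic.exists_ribbonGraph`).

A handle slide is an elementary congruence of the matrix (`ofMatrix_slide`), and the set system
determines the matrix (`ofMatrix_injective`). The canonical forms are the matched matrices, with at
most one nonzero entry per row. It remains to join a graphic `A` to a matched `C` through graphic
matrices, given that they are joined by unrestricted slides (`IsGraphic.slideConn`).

The argument is the classification of surfaces. Sliding `a` over `b` keeps the matrix graphic when
ends of `a` and `b` are adjacent (`IsWord.slide_adjacent`). Such slides split off half-twisted loops
and interlaced pairs one at a time, so `A` reaches a matched `B` (`IsGraphic.exists_matching`).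
Nullity and the vanishing of the diagonal are congruence invariants. With zero diagonal, `B` and `C`
have equally many pairs and differ by a relabelling. Otherwise an interlaced pair beside a
half-twisted loop is traded for half-twisted loops, both `B` and `C` become diagonal, and the two
diagonal forms differ by a relabelling; slides are reversible, so the path from `C` is run
backwards. Relabellings are products of transpositions, each realised by three slides between
adjacent letters, because a matched matrix has a word in which any two prescribed letters are
adjacent (`slideConn_submatrix`). -/

/-! ### Binary delta-matroids and congruence of symmetric matrices -/

namespace SetSystem

variable {E : Type*} [Fintype E]

/-- The set system of the nonsingular principal submatrices of a matrix over the two-element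
field. -/
def ofMatrix (A : Matrix E E (ZMod 2)) : SetSystem E where
  feasible := {X | ∀ y : E → ZMod 2, (∀ e ∉ X, y e = 0) → (∀ e ∈ X, (A *ᵥ y) e = 0) → y = 0}

theorem mem_ofMatrix {A : Matrix E E (ZMod 2)} {X : Set E} :
    X ∈ (ofMatrix A).feasible ↔
      ∀ y : E → ZMod 2, (∀ e ∉ X, y e = 0) → (∀ e ∈ X, (A *ᵥ y) e = 0) → y = 0 := Iff.rfl

/-- The symmetric exchange axiom for the nonsingular principal submatrices. -/
theorem isDeltaMatroid_ofMatrix {A : Matrix E E (ZMod 2)} (hA : A.IsSymm) :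
    (ofMatrix A).IsDeltaMatroid := by
  classical
  refine ⟨⟨∅, fun y hy _ => funext fun e => hy e (by simp)⟩, ?_⟩
  intro X hX Y hY u hu
  -- Principal pivoting on `X`: `q` is bijective because `X` is feasible, and `p = B q` for a matrix
  -- `B` with columns `p (x e)`. `B` is symmetric, and `X ∆ Z` is feasible when `B[Z]` is
  -- nonsingular.
  let q : (E → ZMod 2) →ₗ[ZMod 2] (E → ZMod 2) :=
    LinearMap.pi fun e => if e ∈ X then (LinearMap.proj e).comp A.mulVecLin else LinearMap.proj e
  let p : (E → ZMod 2) →ₗ[ZMod 2] (E → ZMod 2) :=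
    LinearMap.pi fun e => if e ∈ X then LinearMap.proj e else (LinearMap.proj e).comp A.mulVecLin
  have hq : ∀ x e, q x e = if e ∈ X then (A *ᵥ x) e else x e := by
    intro x e; simp only [q, LinearMap.pi_apply]; split_ifs <;> simp
  have hp : ∀ x e, p x e = if e ∈ X then x e else (A *ᵥ x) e := by
    intro x e; simp only [p, LinearMap.pi_apply]; split_ifs <;> simp
  have hqinj : Function.Injective q := by
    rw [← LinearMap.ker_eq_bot, LinearMap.ker_eq_bot']
    intro x hx
    refine hX x (fun e he => ?_) (fun e he => ?_)
    · have := congrFun hx e; rw [hq, if_neg he] at this; exact this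
    · have := congrFun hx e; rw [hq, if_pos he] at this; exact this
  have hqsurj : Function.Surjective q := LinearMap.injective_iff_surjective.mp hqinj
  choose x hx using fun e => hqsurj (Pi.single e 1)
  have hsymm : ∀ y z : E → ZMod 2, p y ⬝ᵥ q z = q y ⬝ᵥ p z := by
    intro y z
    have h1 : y ⬝ᵥ A *ᵥ z = (A *ᵥ y) ⬝ᵥ z := by
      rw [Matrix.dotProduct_mulVec, ← Matrix.mulVec_transpose, hA.eq]
    have h2 : p y ⬝ᵥ q z + q y ⬝ᵥ p z = y ⬝ᵥ A *ᵥ z + (A *ᵥ y) ⬝ᵥ z := by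
      simp only [dotProduct, ← Finset.sum_add_distrib]
      refine Finset.sum_congr rfl fun e _ => ?_
      rw [hq, hp, hq, hp]; split_ifs <;> ring
    rw [h1, CharTwo.add_self_eq_zero] at h2
    exact (CharTwo.add_eq_zero).mp h2
  have hB : ∀ e f, p (x e) f = p (x f) e := by
    intro e f
    have := hsymm (x e) (x f)
    rw [hx, hx] at this
    simpa using this
  -- the sets `X ∆ Z` in terms of the coordinates `p` and `q`
  have hfeas : ∀ Z : Set E, (∀ z, (∀ e ∈ Z, p z e = 0) → (∀ e ∉ Z, q z e = 0) → z = 0) →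
      X ∆ Z ∈ (ofMatrix A).feasible := by
    intro Z h y hy1 hy2
    refine h y (fun e he => ?_) (fun e he => ?_)
    · rw [hp]; split_ifs with hX
      · exact hy1 e (by simp [Set.mem_symmDiff, he, hX])
      · exact hy2 e (by simp [Set.mem_symmDiff, he, hX])
    · rw [hq]; split_ifs with hX
      · exact hy2 e (by simp [Set.mem_symmDiff, he, hX])
      · exact hy1 e (by simp [Set.mem_symmDiff, he, hX])
  -- A nonzero diagonal entry of `B` at `u` is a pivot by itself. Otherwise some `v ∈ X ∆ Y` has a
  -- nonzero entry in row `u`, since `x u` would else be a kernel vector for `Y`; the minor on `{u,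
  -- v}` is then nonzero.
  by_cases huu : p (x u) u = 0
  · obtain ⟨v, hv, huv⟩ : ∃ v ∈ X ∆ Y, p (x u) v ≠ 0 := by
      by_contra! hcon
      have h0 : x u = 0 := by
        have hYe : ∀ e, (e ∉ Y → x u e = 0) ∧ (e ∈ Y → (A *ᵥ x u) e = 0) := by
          intro e
          by_cases heXY : e ∈ X ∆ Y
          · have := hcon e heXY
            rw [hp] at this
            rw [Set.mem_symmDiff] at heXY
            by_cases heX : e ∈ X <;> simp_all
          · have h := congrFun (hx u) e
            rw [Pi.single_eq_of_ne (by rintro rfl; exact heXY hu), hq] at h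
            rw [Set.mem_symmDiff] at heXY
            by_cases heX : e ∈ X <;> simp_all
        exact hY _ (fun e => (hYe e).1) (fun e => (hYe e).2)
      have := hx u
      rw [h0, map_zero] at this
      simpa using congrFun this u
    have hne : u ≠ v := by rintro rfl; exact huv huu
    refine ⟨v, hv, hfeas _ fun z hz1 hz2 => ?_⟩
    have hz : z = q z u • x u + q z v • x v := by
      apply hqinj
      rw [map_add, map_smul, map_smul, hx, hx]
      funext e
      by_cases h1 : e = u
      · subst h1; simp [hne]
      by_cases h2 : e = v
      · subst h2; simp [h1]
      simp [h1, h2, hz2 e (by simp [h1, h2])]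
    have e1 := hz1 u (by simp)
    have e2 := hz1 v (by simp)
    rw [hz, map_add, map_smul, map_smul] at e1 e2
    simp only [Pi.add_apply, Pi.smul_apply, smul_eq_mul, huu, mul_zero, zero_add] at e1 e2
    rw [hB v u] at e1
    have h3 := (mul_eq_zero.mp e1).resolve_right huv
    rw [h3] at e2
    have h4 := (mul_eq_zero.mp (by simpa using e2)).resolve_right huv
    rw [hz, h3, h4]; simp
  · refine ⟨u, hu, hfeas _ fun z hz1 hz2 => ?_⟩
    have hz : z = q z u • x u := by
      apply hqinj
      rw [map_smul, hx]
      funext e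
      by_cases h1 : e = u
      · subst h1; simp
      simp [h1, hz2 e (by simp [h1])]
    have e1 := hz1 u (by simp)
    rw [hz, map_smul] at e1
    simp only [Pi.smul_apply, smul_eq_mul] at e1
    rw [hz, (mul_eq_zero.mp e1).resolve_right huu]; simp

/-- Extension by zero identifies vectors on `ι` with vectors supported on the range of `g`. The free
index type allows `X ∪ {a}` and `X ∪ {b}` to share the index type `Option X`, so that their
determinants can be added. -/
theorem mem_ofMatrix_range_iff {ι : Type*} [Fintype ι] [DecidableEq ι]
    (A : Matrix E E (ZMod 2)) {g : ι → E} (hg : Function.Injective g) :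
    Set.range g ∈ (ofMatrix A).feasible ↔ (A.submatrix g g).det ≠ 0 := by
  classical
  have key : ∀ (y : E → ZMod 2), (∀ e ∉ Set.range g, y e = 0) → ∀ i,
      (A.submatrix g g *ᵥ (y ∘ g)) i = (A *ᵥ y) (g i) := by
    intro y hy i
    simp only [Matrix.mulVec, dotProduct, Matrix.submatrix_apply, Function.comp]
    exact Finset.sum_of_injOn g hg.injOn (by simp [Set.MapsTo])
      (fun e _ he => by rw [hy e (by simpa using he), mul_zero]) (fun _ _ => rfl)
  rw [Ne, ← Matrix.exists_mulVec_eq_zero_iff, mem_ofMatrix]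
  push Not
  constructor
  · intro h v hv hMv
    apply hv
    have hy : ∀ e ∉ Set.range g, Function.extend g v 0 e = 0 := fun e he =>
      Function.extend_apply' _ _ _ (by simpa using he)
    have hyg : Function.extend g v 0 ∘ g = v := funext fun i => hg.extend_apply _ _ _
    have h0 := h (Function.extend g v 0) hy (by
      rintro _ ⟨i, rfl⟩
      rw [← key _ hy, hyg, hMv, Pi.zero_apply])
    rw [← hyg, h0]; rfl
  · intro h y hy hAy
    have h0 : y ∘ g = 0 := by
      by_contra hne
      exact h _ hne (funext fun i => by rw [key _ hy, hAy _ ⟨i, rfl⟩, Pi.zero_apply])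
    funext e
    by_cases he : e ∈ Set.range g
    · obtain ⟨i, rfl⟩ := he; exact congrFun h0 i
    · exact hy e he

end SetSystem

namespace Matrix

variable {E : Type*} [DecidableEq E]

/-- The elementary congruence that adds row `b` to row `a` and column `b` to column `a`. -/
def slide (A : Matrix E E (ZMod 2)) (a b : E) : Matrix E E (ZMod 2) :=
  Matrix.of fun e f => A e f + (if e = a then A b f else 0) + (if f = a then A e b else 0) +
    (if e = a ∧ f = a then A b b else 0)

theorem slide_apply (A : Matrix E E (ZMod 2)) (a b e f : E) :
    A.slide a b e f = A e f + (if e = a then A b f else 0) + (if f = a then A e b else 0) +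
      (if e = a ∧ f = a then A b b else 0) := rfl

theorem IsSymm.slide {A : Matrix E E (ZMod 2)} (hA : A.IsSymm) (a b : E) :
    (A.slide a b).IsSymm := by
  ext e f
  rw [transpose_apply, slide_apply, slide_apply, hA.apply e f, hA.apply b e, hA.apply f b]
  simp only [and_comm]
  ring

theorem slide_slide (A : Matrix E E (ZMod 2)) {a b : E} (h : a ≠ b) :
    (A.slide a b).slide a b = A := by
  ext e f
  simp only [slide_apply]
  have h2 : ∀ x : ZMod 2, x + x = 0 := CharTwo.add_self_eq_zero
  grind

/-- Three elementary congruences exchange two rows and the corresponding columns. -/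
theorem slide_slide_slide (A : Matrix E E (ZMod 2)) {a b : E} (h : a ≠ b) :
    ((A.slide a b).slide b a).slide a b = A.submatrix (Equiv.swap a b) (Equiv.swap a b) := by
  ext e f
  simp only [slide_apply, submatrix_apply, Equiv.swap_apply_def]
  have h2 : ∀ x : ZMod 2, x + x = 0 := CharTwo.add_self_eq_zero
  grind

/-- The slide is `P A Pᵀ`: here `Pᵀ` adds the coordinate `y a` to the coordinate at `b`, and `P`
adds the coordinate at `b` to the one at `a`. -/
theorem slide_mulVec [Fintype E] (A : Matrix E E (ZMod 2)) (a b : E) (y : E → ZMod 2) (e : E) :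
    (A.slide a b *ᵥ y) e =
      (A *ᵥ (y + Pi.single b (y a))) e +
        if e = a then (A *ᵥ (y + Pi.single b (y a))) b else 0 := by
  rw [mulVec_add, mulVec_single]
  simp only [mulVec, dotProduct, slide_apply, add_mul, Finset.sum_add_distrib, ite_mul, zero_mul,
    Finset.sum_ite_eq', Finset.mem_univ, if_true, ite_and, Pi.add_apply, Pi.smul_apply]
  by_cases he : e = a
  · simp [he]; ring
  · simp [he]

end Matrix

namespace SetSystem

variable {E : Type*} [Fintype E] [DecidableEq E]

/-- When `a ∈ X` forces `b ∈ X`, the substitution preserves support in `X`, and adding coordinate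
`b` to coordinate `a` does not change whether a vector vanishes on `X`. The kernel conditions
therefore correspond. -/
theorem mem_ofMatrix_slide_of_mem_iff {A : Matrix E E (ZMod 2)} {a b : E} (h : a ≠ b) {X : Set E}
    (hX : a ∈ X → b ∈ X) :
    X ∈ (ofMatrix (A.slide a b)).feasible ↔ X ∈ (ofMatrix A).feasible := by
  have key : ∀ B : Matrix E E (ZMod 2), X ∈ (ofMatrix B).feasible →
      X ∈ (ofMatrix (B.slide a b)).feasible := by
    intro B hB y hy hBy
    have h0 := hB (y + Pi.single b (y a)) (fun e he => by
      rw [Pi.add_apply, hy e he, zero_add]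
      by_cases heb : e = b
      · subst heb
        rw [Pi.single_eq_same, hy a (fun ha => he (hX ha))]
      · rw [Pi.single_eq_of_ne heb]) (fun e he => by
      have h1 := hBy e he
      rw [Matrix.slide_mulVec] at h1
      by_cases hea : e = a
      · subst hea
        have h2 := hBy b (hX he)
        rw [Matrix.slide_mulVec, if_neg h.symm, add_zero] at h2
        rwa [if_pos rfl, h2, add_zero] at h1
      · rwa [if_neg hea, add_zero] at h1)
    have ha : y a = 0 := by
      have := congrFun h0 a
      rwa [Pi.add_apply, Pi.single_eq_of_ne h, add_zero] at this
    rwa [ha, Pi.single_zero, add_zero] at h0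
  refine ⟨fun hm => ?_, key A⟩
  have := key _ hm
  rwa [Matrix.slide_slide A h] at this

-- The determinant is expanded in the row and the column that the slide alters. Of the four terms,
-- the two mixed ones are transposes of each other and cancel in characteristic two.
omit [Fintype E] in
theorem det_slide_submatrix {ι : Type*} [Fintype ι] [DecidableEq ι] {A : Matrix E E (ZMod 2)}
    (hA : A.IsSymm) {a b : E} {g : E → Option ι → E} (hn : ∀ c, g c none = c)
    (hs : ∀ c d i, g c (some i) = g d (some i)) (ha : ∀ c i, g c (some i) ≠ a) :
    ((A.slide a b).submatrix (g a) (g a)).det =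
      (A.submatrix (g a) (g a)).det + (A.submatrix (g b) (g b)).det := by
  let C : E → Matrix (Option ι) (Option ι) (ZMod 2) := fun c =>
    Matrix.of fun i j => A (g c i) (g a j) + if j = none then A (g c i) b else 0
  have hC : ∀ c, (C c).det = (A.submatrix (g c) (g a)).det + (A.submatrix (g c) (g b)).det := by
    intro c
    have h1 : C c = (A.submatrix (g c) (g a)).updateCol none
        ((fun i => A (g c i) a) + fun i => A (g c i) b) := by
      ext i j
      rcases j with _ | j <;> simp [C, hn]
    have h2 : (A.submatrix (g c) (g a)).updateCol none (fun i => A (g c i) a) =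
        A.submatrix (g c) (g a) := by
      ext i j
      rcases j with _ | j <;> simp [hn]
    have h3 : (A.submatrix (g c) (g a)).updateCol none (fun i => A (g c i) b) =
        A.submatrix (g c) (g b) := by
      ext i j
      rcases j with _ | j <;> simp [hn, hs a b]
    rw [h1, Matrix.det_updateCol_add, h2, h3]
  have h1 : (A.slide a b).submatrix (g a) (g a) = (C a).updateRow none (C a none + C b none) := by
    ext i j
    rcases i with _ | i <;> rcases j with _ | j <;>
      simp [C, Matrix.updateRow_apply, Matrix.slide_apply, hn, ha]
    ring
  have h2 : (C a).updateRow none (C a none) = C a := by simp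
  have h3 : (C a).updateRow none (C b none) = C b := by
    ext i j
    rcases i with _ | i <;> simp [C, Matrix.updateRow_apply, hs a b]
  have h4 : (A.submatrix (g b) (g a)).det = (A.submatrix (g a) (g b)).det := by
    rw [← Matrix.det_transpose, Matrix.transpose_submatrix, hA.eq]
  rw [h1, Matrix.det_updateRow_add, h2, h3, hC, hC, h4]
  linear_combination CharTwo.add_self_eq_zero (A.submatrix (g a) (g b)).det

/-- Handle slides of binary delta-matroids are elementary congruences. -/
theorem ofMatrix_slide {A : Matrix E E (ZMod 2)} (hA : A.IsSymm) {a b : E} (h : a ≠ b) :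
    ofMatrix (A.slide a b) = (ofMatrix A).handleSlide a b := by
  ext Y
  change _ ↔ Y ∈ (ofMatrix A).feasible ∆ _
  rw [Set.mem_symmDiff]
  -- Only sets that contain `a` and miss `b` can be affected by the handle slide.
  by_cases hY : a ∈ Y → b ∈ Y
  · rw [mem_ofMatrix_slide_of_mem_iff h hY]
    have : Y ∉ {Y | ∃ X : Set E, a ∉ X ∧ b ∉ X ∧ insert b X ∈ (ofMatrix A).feasible ∧
        Y = insert a X} := by
      rintro ⟨X, -, hbX, -, rfl⟩
      exact hbX ((hY (Set.mem_insert _ _)).resolve_left h.symm)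
    tauto
  · push Not at hY
    obtain ⟨haY, hbY⟩ := hY
    obtain ⟨X, haX, rfl⟩ : ∃ X : Set E, a ∉ X ∧ Y = insert a X :=
      ⟨Y \ {a}, by simp, by simp [Set.insert_eq_of_mem haY]⟩
    have hbX : b ∉ X := fun hb => hbY (Or.inr hb)
    have hiff : insert a X ∈ {Y | ∃ X : Set E, a ∉ X ∧ b ∉ X ∧
        insert b X ∈ (ofMatrix A).feasible ∧ Y = insert a X} ↔
        insert b X ∈ (ofMatrix A).feasible := by
      constructor
      · rintro ⟨Z, haZ, hbZ, hZ, heq⟩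
        have : X = Z := by
          ext e
          have := Set.ext_iff.mp heq e
          by_cases hea : e = a
          · subst hea; tauto
          · simpa [hea] using this
        rwa [this]
      · exact fun hm => ⟨X, haX, hbX, hm, rfl⟩
    rw [hiff]
    classical
    let g : E → Option X → E := fun c i => i.elim c Subtype.val
    have hrange : ∀ c, Set.range (g c) = insert c X := by
      intro c; ext e; simp [g, Option.exists, eq_comm]
    have hg : ∀ c, c ∉ X → Function.Injective (g c) := by
      rintro c hc (_ | i) (_ | j) hij
      · rfl
      · exact absurd (show c ∈ X by have : c = j := hij; rw [this]; exact j.2) hc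
      · exact absurd (show c ∈ X by have : i = c := hij; rw [← this]; exact i.2) hc
      · exact congrArg some (Subtype.ext hij)
    rw [← hrange a, ← hrange b, mem_ofMatrix_range_iff _ (hg a haX),
      mem_ofMatrix_range_iff _ (hg a haX), mem_ofMatrix_range_iff _ (hg b hbX),
      det_slide_submatrix hA (g := g) (fun _ => rfl) (fun _ _ _ => rfl)
        (fun c i hi => haX (by rw [← hi]; exact i.2))]
    generalize (A.submatrix (g a) (g a)).det = p
    generalize (A.submatrix (g b) (g b)).det = q
    revert p q
    decide

omit [DecidableEq E] in
/-- A symmetric matrix over the two-element field is determined by its nonsingular principal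
submatrices. -/
theorem ofMatrix_injective {A B : Matrix E E (ZMod 2)} (hA : A.IsSymm) (hB : B.IsSymm)
    (h : ofMatrix A = ofMatrix B) : A = B := by
  have hdiag : ∀ e, A e e = B e e := by
    intro e
    have key : ∀ M : Matrix E E (ZMod 2), {e} ∈ (ofMatrix M).feasible ↔ M e e ≠ 0 := by
      intro M
      have := mem_ofMatrix_range_iff M (g := fun _ : Unit => e) (fun _ _ _ => rfl)
      rwa [Set.range_const, Matrix.det_unique] at this
    have := key A
    rw [h, key B] at this
    generalize A e e = p at *
    generalize B e e = q at *
    revert p q; decide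
  ext e f
  rcases eq_or_ne e f with rfl | hef
  · exact hdiag e
  -- Once the diagonal is known, the minor on a pair gives the square of the off-diagonal entry, and
  -- squaring is injective on the two-element field.
  have key : ∀ M : Matrix E E (ZMod 2), M.IsSymm →
      ({e, f} ∈ (ofMatrix M).feasible ↔ M e e * M f f - M e f * M e f ≠ 0) := by
    intro M hM
    have := mem_ofMatrix_range_iff M (g := ![e, f]) (by
      intro i j; fin_cases i <;> fin_cases j <;> simp [hef, hef.symm])
    rw [Matrix.det_fin_two] at this
    simpa [hM.apply, Set.pair_comm] using this
  have h1 := key A hA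
  rw [h, key B hB, hdiag, hdiag] at h1
  generalize A e f = p at *
  generalize B e f = q at *
  generalize B e e * B f f = r at *
  revert p q r; decide

end SetSystem

/-! ### Double occurrence words and their interlacement matrices -/

/-- The number, modulo two, of the pairs of positions in a word at which `e` occurs before `f`. -/
def List.orderedPairs {E : Type*} [DecidableEq E] : List E → E → E → ZMod 2
  | [], _, _ => 0
  | g :: L, e, f => (if g = e then (L.count f : ZMod 2) else 0) + L.orderedPairs e f

section Words

variable {E : Type*} [DecidableEq E]

theorem List.orderedPairs_append (L M : List E) (e f : E) :
    (L ++ M).orderedPairs e f =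
      L.orderedPairs e f + M.orderedPairs e f + L.count e * M.count f := by
  induction L with
  | nil => simp [orderedPairs]
  | cons g L ih =>
    simp only [cons_append, orderedPairs, ih, count_append, count_cons, beq_iff_eq]
    split_ifs <;> push_cast <;> ring

theorem List.orderedPairs_reverse (L : List E) (e f : E) :
    L.reverse.orderedPairs e f = L.orderedPairs f e := by
  induction L with
  | nil => simp [orderedPairs]
  | cons g L ih =>
    simp only [reverse_cons, orderedPairs_append, orderedPairs, ih, count_reverse, count_cons,
      beq_iff_eq, count_nil]
    split_ifs <;> push_cast <;> ring

theorem List.orderedPairs_eq_zero {L : List E} {e f : E} (h : e ∉ L ∨ f ∉ L) :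
    L.orderedPairs e f = 0 := by
  induction L with
  | nil => rfl
  | cons g L ih =>
    simp only [mem_cons, not_or] at h
    simp only [orderedPairs]
    rw [ih (h.imp And.right And.right), add_zero]
    split_ifs with hg
    · rw [count_eq_zero.mpr (h.resolve_left fun h => h.1 hg.symm).2, Nat.cast_zero]
    · rfl

namespace Matrix

/-- Every letter of `S` occurs twice in `L`, no other letter occurs, and the off-diagonal entries of
`A` on `S` tell which letters are interlaced. -/
def IsWord (A : Matrix E E (ZMod 2)) (S : Finset E) (L : List E) : Prop :=
  (∀ e, L.count e = if e ∈ S then 2 else 0) ∧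
    ∀ e ∈ S, ∀ f ∈ S, e ≠ f → A e f = L.orderedPairs e f

namespace IsWord

variable {A : Matrix E E (ZMod 2)} {S T : Finset E} {L M : List E}

theorem mem_of_mem (h : IsWord A S L) {e : E} (he : e ∈ L) : e ∈ S := by
  by_contra hS
  have := h.1 e
  rw [if_neg hS, List.count_eq_zero] at this
  exact this he

/-- Each letter occurs equally often modulo two in `L` and in `M`, so the cross terms of the two
concatenations agree. -/
theorem rotate (h : IsWord A S (L ++ M)) : IsWord A S (M ++ L) := by
  refine ⟨fun e => by rw [← h.1 e, List.count_append, List.count_append, add_comm], ?_⟩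
  intro e he f hf hef
  rw [h.2 e he f hf hef, List.orderedPairs_append, List.orderedPairs_append]
  have h1 : ∀ x ∈ S, (L.count x : ZMod 2) = M.count x := by
    intro x hx
    have := h.1 x
    rw [if_pos hx, List.count_append] at this
    have := congrArg (Nat.cast : ℕ → ZMod 2) this
    push_cast at this
    exact CharTwo.add_eq_zero.mp (this.trans rfl)
  rw [h1 e he, h1 f hf]
  ring

theorem reverse (h : IsWord A S L) (hA : A.IsSymm) : IsWord A S L.reverse := by
  refine ⟨fun e => by rw [← h.1 e, List.count_reverse], ?_⟩
  intro e he f hf hef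
  rw [List.orderedPairs_reverse, ← h.2 f hf e he hef.symm, hA.apply]

/-- Every letter occurs an even number of times in `M`, so the cross term of the concatenation
vanishes. -/
theorem append (hL : IsWord A S L) (hM : IsWord A T M) (hA : A.IsSymm) (hST : Disjoint S T)
    (h0 : ∀ e ∈ S, ∀ f ∈ T, A e f = 0) : IsWord A (S ∪ T) (L ++ M) := by
  have hcount : ∀ {S : Finset E} {L : List E}, IsWord A S L → ∀ e, (L.count e : ZMod 2) = 0 := by
    intro S L h e
    rw [h.1 e]; split_ifs <;> rfl
  have hout : ∀ {S : Finset E} {L : List E}, IsWord A S L → ∀ e f, e ∉ S ∨ f ∉ S →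
      L.orderedPairs e f = 0 := by
    intro S L h e f hef
    refine List.orderedPairs_eq_zero (hef.imp ?_ ?_) <;> intro hx <;>
      rw [← List.count_eq_zero, h.1, if_neg hx]
  refine ⟨fun e => ?_, fun e he f hf hef => ?_⟩
  · have hd : e ∈ S → e ∉ T := fun h => Finset.disjoint_left.mp hST h
    rw [List.count_append, hL.1, hM.1]; simp only [Finset.mem_union]
    split_ifs <;> simp_all
  · rw [List.orderedPairs_append, hcount hM, mul_zero, add_zero]
    rw [Finset.mem_union] at he hf
    have hde : e ∈ S → e ∉ T := fun h => Finset.disjoint_left.mp hST h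
    have hdf : f ∈ S → f ∉ T := fun h => Finset.disjoint_left.mp hST h
    rcases he with he | he <;> rcases hf with hf | hf
    · rw [hout hM e f (Or.inl (hde he)), add_zero, hL.2 e he f hf hef]
    · rw [hout hL e f (Or.inr fun h => hdf h hf), hout hM e f (Or.inl (hde he)), add_zero,
        h0 e he f hf]
    · rw [hout hL e f (Or.inl fun h => hde h he), hout hM e f (Or.inr (hdf hf)), add_zero,
        ← hA.apply, h0 f hf e he]
    · rw [hout hL e f (Or.inl fun h => hde h he), zero_add, hM.2 e he f hf hef]

/-- If ends of `a` and `b` are adjacent, the end of `a` can be slid along `b` to the other end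
of `b`. -/
theorem slide_adjacent {a b : E} {v z : List E} (hA : A.IsSymm) (hab : a ≠ b)
    (h : IsWord A S (a :: b :: (v ++ b :: z))) :
    IsWord (A.slide a b) S
      (b :: (v ++ if A b b = 1 then a :: b :: z else b :: a :: z)) := by
  have haS : a ∈ S := h.mem_of_mem (by simp)
  have hbS : b ∈ S := h.mem_of_mem (by simp)
  refine ⟨fun e => ?_, ?_⟩
  · rw [← h.1 e]
    split_ifs <;> simp only [List.count_cons, List.count_append] <;> omega
  intro e he f hf hef
  have hb : A b b = 0 ∨ A b b = 1 := by
    generalize A b b = p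
    revert p; decide
  have hc := h.1
  have h2 : ∀ x : ZMod 2, x + x = 0 := CharTwo.add_self_eq_zero
  have hw := h.2
  -- Only parities in `v` and `z` matter: letters other than `a` and `b` have equal parities there,
  -- the second `a` lies in exactly one of the two, and `b` in neither. What remains is a case check
  -- on which of `e`, `f` equal `a` or `b`.
  have hc2 : ∀ x ∈ S, x ≠ a → x ≠ b → (v.count x : ZMod 2) = z.count x := by
    intro x hx hxa hxb
    have := hc x
    simp [hxa.symm, hxb.symm, hx] at this
    exact CharTwo.add_eq_zero.mp (by exact_mod_cast congrArg (Nat.cast : ℕ → ZMod 2) this)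
  have hca : (v.count a : ZMod 2) = 1 + z.count a := by
    have := hc a
    simp [hab.symm, haS] at this
    have : (v.count a : ZMod 2) + z.count a = 1 := by
      exact_mod_cast congrArg (Nat.cast : ℕ → ZMod 2) (show v.count a + z.count a = 1 by omega)
    rw [← this]; linear_combination h2 (-z.count a)
  have hcb := hc b
  simp [hab, hbS] at hcb
  have hcb1 : b ∉ v := by rw [← List.count_eq_zero]; omega
  have hcb2 : b ∉ z := by rw [← List.count_eq_zero]; omega
  have hv : ∀ x, v.orderedPairs b x = 0 := fun x => List.orderedPairs_eq_zero (Or.inl hcb1)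
  have hz : ∀ x, z.orderedPairs b x = 0 := fun x => List.orderedPairs_eq_zero (Or.inl hcb2)
  have hv' : v.orderedPairs e b = 0 := List.orderedPairs_eq_zero (Or.inr hcb1)
  have hz' : z.orderedPairs e b = 0 := List.orderedPairs_eq_zero (Or.inr hcb2)
  replace hcb1 : (v.count b : ZMod 2) = 0 := by rw [List.count_eq_zero.mpr hcb1, Nat.cast_zero]
  replace hcb2 : (z.count b : ZMod 2) = 0 := by rw [List.count_eq_zero.mpr hcb2, Nat.cast_zero]
  have hAe : ∀ x ∈ S, x ≠ b → A x b = A b x := fun x _ _ => hA.apply _ _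
  have hw1 := hw b hbS f hf
  have hw4 := hw b hbS e he
  have hw2 := hw e he f hf hef
  have hw3 := hAe e he
  clear hc hcb h hA hw hAe
  have hce := hc2 e he
  have hcf := hc2 f hf
  clear hc2
  simp only [List.orderedPairs, List.orderedPairs_append, List.count_cons, List.count_append,
    Nat.cast_add, Nat.cast_ite, Nat.cast_one, Nat.cast_zero, beq_iff_eq, slide_apply, hcb1, hv,
    hz] at hw1 hw4 hw2 ⊢
  split_ifs with hb1
  all_goals
    simp only [List.orderedPairs, List.count_cons, Nat.cast_add, Nat.cast_ite, Nat.cast_one,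
      Nat.cast_zero, beq_iff_eq]
    grind

theorem slide_twisted {a b : E} {v z : List E} (hA : A.IsSymm) (hab : a ≠ b) (hb : A b b = 1)
    (h : IsWord A S (a :: b :: (v ++ b :: z))) :
    IsWord (A.slide a b) S (b :: (v ++ a :: b :: z)) := by
  have := h.slide_adjacent hA hab
  rwa [if_pos hb] at this

theorem slide_untwisted {a b : E} {v z : List E} (hA : A.IsSymm) (hab : a ≠ b) (hb : A b b = 0)
    (h : IsWord A S (a :: b :: (v ++ b :: z))) :
    IsWord (A.slide a b) S (b :: (v ++ b :: a :: z)) := by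
  have := h.slide_adjacent hA hab
  rwa [if_neg (by rw [hb]; decide)] at this

end IsWord

end Matrix
end Words

/-! ### Reduction of interlacement matrices by slides -/

namespace Matrix

variable {E : Type*} [DecidableEq E]

/-- The row of `e` has at most one nonzero entry. -/
def IsMatchingRow (A : Matrix E E (ZMod 2)) (e : E) : Prop :=
  ∀ f g, A e f ≠ 0 → A e g ≠ 0 → f = g

/-- No letter of `S` interacts with a letter outside `S`. -/
def IsClosed (A : Matrix E E (ZMod 2)) (S : Finset E) : Prop :=
  ∀ e ∈ S, ∀ f ∉ S, A e f = 0

omit [DecidableEq E] in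
theorem eq_one_of_ne_zero {A : Matrix E E (ZMod 2)} {e f : E} (h : A e f ≠ 0) : A e f = 1 := by
  revert h; generalize A e f = p; revert p; decide

/-- Every letter `a` of a matched part lies in a block that is a word ending in `a`. -/
theorem exists_block {A : Matrix E E (ZMod 2)} (hA : A.IsSymm) {S : Finset E} (hS : A.IsClosed S)
    (hm : ∀ e ∈ S, A.IsMatchingRow e) {a : E} (ha : a ∈ S) :
    ∃ (T : Finset E) (l : List E), a ∈ T ∧ T ⊆ S ∧ A.IsWord T (l ++ [a]) ∧ A.IsClosed T ∧
      ∀ f ∈ T, f = a ∨ ∃ l', l = f :: l' := by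
  by_cases h : ∃ f, f ≠ a ∧ A a f ≠ 0
  · obtain ⟨f, hfa, hf⟩ := h
    have hfS : f ∈ S := by
      by_contra hn
      exact hf (hS a ha f hn)
    have hf' : A f a ≠ 0 := by rwa [hA.apply]
    refine ⟨{a, f}, [f, a, f], by simp, ?_, ⟨?_, ?_⟩, ?_, ?_⟩
    · intro x hx
      rcases Finset.mem_insert.mp hx with rfl | hx
      · exact ha
      · rwa [Finset.mem_singleton.mp hx]
    · intro e
      simp only [List.cons_append, List.nil_append, List.count_cons, List.count_nil, beq_iff_eq,
        Finset.mem_insert, Finset.mem_singleton]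
      rcases eq_or_ne a e with rfl | h1
      · simp [hfa]
      · rcases eq_or_ne f e with rfl | h2
        · simp [h1]
        · simp [h1, h2, h1.symm, h2.symm]
    · intro x hx y hy hxy
      simp only [Finset.mem_insert, Finset.mem_singleton] at hx hy
      rcases hx with rfl | rfl <;> rcases hy with rfl | rfl
      · exact absurd rfl hxy
      · simp [List.orderedPairs, hfa, eq_one_of_ne_zero hf]
      · simp [List.orderedPairs, hxy, hxy.symm, eq_one_of_ne_zero hf']
        decide
      · exact absurd rfl hxy
    · intro x hx y hy
      simp only [Finset.mem_insert, Finset.mem_singleton, not_or] at hx hy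
      by_contra hne
      rcases hx with rfl | rfl
      · exact hy.2 (hm _ ha _ _ hne hf)
      · exact hy.1 (hm _ hfS _ _ hne hf')
    · intro x hx
      rcases Finset.mem_insert.mp hx with rfl | hx
      · exact Or.inl rfl
      · rw [Finset.mem_singleton.mp hx]; exact Or.inr ⟨_, rfl⟩
  · push Not at h
    refine ⟨{a}, [a], by simp, by simpa using ha, ⟨?_, ?_⟩, ?_, ?_⟩
    · intro e
      simp only [List.cons_append, List.nil_append, List.count_cons, List.count_nil, beq_iff_eq,
        Finset.mem_singleton]
      rcases eq_or_ne a e with rfl | h1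
      · simp
      · simp [h1, h1.symm]
    · intro x hx y hy hxy
      rw [Finset.mem_singleton] at hx hy
      exact absurd (hx.trans hy.symm) hxy
    · intro x hx y hy
      rw [Finset.mem_singleton] at hx hy
      rw [hx]; exact h y hy
    · intro x hx
      exact Or.inl (Finset.mem_singleton.mp hx)

theorem IsClosed.sdiff {A : Matrix E E (ZMod 2)} (hA : A.IsSymm) {S T : Finset E}
    (hS : A.IsClosed S) (hT : A.IsClosed T) : A.IsClosed (S \ T) := by
  intro e he f hf
  rw [Finset.mem_sdiff] at he hf
  by_cases h : f ∈ S
  · have : f ∈ T := by tauto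
    rw [← hA.apply]
    exact hT f this e he.2
  · exact hS e he.1 f h

/-- Blocks are split off one by one; a block does not interact with its complement, so the words are
concatenated. -/
theorem exists_isWord {A : Matrix E E (ZMod 2)} (hA : A.IsSymm) (S : Finset E)
    (hS : A.IsClosed S) (hm : ∀ e ∈ S, A.IsMatchingRow e) : ∃ L, A.IsWord S L := by
  induction S using Finset.strongInduction with
  | H S ih =>
    rcases S.eq_empty_or_nonempty with rfl | ⟨a, ha⟩
    · exact ⟨[], by simp [IsWord]⟩
    · obtain ⟨T, l, haT, hTS, hl, hT, -⟩ := exists_block hA hS hm ha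
      obtain ⟨M, hM⟩ := ih (S \ T) (Finset.sdiff_ssubset hTS ⟨a, haT⟩) (hS.sdiff hA hT)
        (fun e he => hm e (Finset.mem_sdiff.mp he).1)
      refine ⟨l ++ [a] ++ M, ?_⟩
      have := hl.append hM hA Finset.disjoint_sdiff
        (fun e he f hf => hT e he f (Finset.mem_sdiff.mp hf).2)
      rwa [Finset.union_sdiff_of_subset hTS] at this

/-- The word `L` presents `A` on `S`, and the other letters are already matched. -/
structure IsPartialWord (A : Matrix E E (ZMod 2)) (S : Finset E) (L : List E) : Prop where
  isSymm : A.IsSymm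
  isWord : A.IsWord S L
  isClosed : A.IsClosed S
  matching : ∀ e ∉ S, A.IsMatchingRow e

theorem slide_apply_of_mem {A : Matrix E E (ZMod 2)} {S : Finset E} (hA : A.IsSymm)
    (hS : A.IsClosed S) {a b : E} (ha : a ∈ S) (hb : b ∈ S) {e : E} (he : e ∉ S) (f : E) :
    A.slide a b e f = A e f := by
  have hea : e ≠ a := fun h => he (h ▸ ha)
  have : A e b = 0 := by rw [← hA.apply]; exact hS b hb e he
  simp [slide_apply, hea, this]

namespace IsPartialWord

variable {A : Matrix E E (ZMod 2)} {S : Finset E} {L M : List E}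

theorem of_isWord (h : A.IsPartialWord S L) (hM : A.IsWord S M) : A.IsPartialWord S M :=
  { h with isWord := hM }

theorem rotate (h : A.IsPartialWord S (L ++ M)) : A.IsPartialWord S (M ++ L) :=
  h.of_isWord h.isWord.rotate

theorem reverse (h : A.IsPartialWord S L) : A.IsPartialWord S L.reverse :=
  h.of_isWord (h.isWord.reverse h.isSymm)

theorem slide (h : A.IsPartialWord S L) {a b : E} (ha : a ∈ S) (hb : b ∈ S)
    (hM : (A.slide a b).IsWord S M) : (A.slide a b).IsPartialWord S M where
  isSymm := h.isSymm.slide a b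
  isWord := hM
  isClosed := by
    intro e he f hf
    rw [← (h.isSymm.slide a b).apply, slide_apply_of_mem h.isSymm h.isClosed ha hb hf,
      h.isSymm.apply]
    exact h.isClosed e he f hf
  matching := by
    intro e he f g hf hg
    rw [slide_apply_of_mem h.isSymm h.isClosed ha hb he] at hf hg
    exact h.matching e he f g hf hg

end IsPartialWord

variable [Fintype E]

/-- A symmetric matrix whose off-diagonal part is the interlacement matrix of a double occurrence
word. -/
def IsGraphic (A : Matrix E E (ZMod 2)) : Prop :=
  A.IsSymm ∧ ∃ L, A.IsWord Finset.univ L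

/-- The letters outside `S` are matched and hence have a word of their own, to be appended to `L`.
-/
theorem IsPartialWord.isGraphic {A : Matrix E E (ZMod 2)} {S : Finset E} {L : List E}
    (h : A.IsPartialWord S L) : A.IsGraphic := by
  have huniv : A.IsClosed (Finset.univ : Finset E) := fun _ _ f hf => absurd (Finset.mem_univ f) hf
  obtain ⟨M, hM⟩ := exists_isWord h.isSymm (Finset.univ \ S) (huniv.sdiff h.isSymm h.isClosed)
    (fun e he => h.matching e (Finset.mem_sdiff.mp he).2)
  refine ⟨h.isSymm, L ++ M, ?_⟩
  have := h.isWord.append hM h.isSymm Finset.disjoint_sdiff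
    (fun e he f hf => h.isClosed e he f (Finset.mem_sdiff.mp hf).2)
  rwa [Finset.union_sdiff_of_subset (Finset.subset_univ S)] at this

/-- One elementary congruence between interlacement matrices. -/
def SlideStep (A A' : Matrix E E (ZMod 2)) : Prop :=
  A.IsGraphic ∧ A'.IsGraphic ∧ ∃ a b, a ≠ b ∧ A' = A.slide a b

/-- Two matrices are joined by elementary congruences between interlacement matrices. -/
def SlideConn : Matrix E E (ZMod 2) → Matrix E E (ZMod 2) → Prop :=
  Relation.ReflTransGen SlideStep

theorem SlideConn.symm {A A' : Matrix E E (ZMod 2)} (h : SlideConn A A') : SlideConn A' A := by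
  induction h with
  | refl => exact .refl
  | tail _ hs ih =>
    obtain ⟨h1, h2, a, b, hab, rfl⟩ := hs
    exact .head ⟨h2, h1, a, b, hab, (slide_slide _ hab).symm⟩ ih

theorem IsPartialWord.slideConn {A : Matrix E E (ZMod 2)} {S : Finset E} {L M : List E}
    (h : A.IsPartialWord S L) {a b : E} (hab : a ≠ b) (hM : (A.slide a b).IsPartialWord S M) :
    SlideConn A (A.slide a b) :=
  .single ⟨h.isGraphic, hM.isGraphic, a, b, hab, rfl⟩

/-- A half-twisted edge `b` can be separated from the other edges. -/
theorem IsPartialWord.exists_separated_loop {S : Finset E} {b : E} (v z : List E)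
    {A : Matrix E E (ZMod 2)} (h : A.IsPartialWord S (b :: (v ++ b :: z))) (hb : A b b = 1) :
    ∃ A' z', SlideConn A A' ∧ A'.IsPartialWord S (b :: b :: z') ∧ A' b b = 1 := by
  induction v using List.reverseRecOn generalizing A z with
  | nil => exact ⟨A, z, .refl, h, hb⟩
  | append_singleton v c ih =>
    have hbS : b ∈ S := h.isWord.mem_of_mem (by simp)
    have hcS : c ∈ S := h.isWord.mem_of_mem (by simp)
    have hcb : c ≠ b := by
      rintro rfl
      have := h.isWord.1 c
      simp [hbS] at this
      omega
    -- The letter `c` stands just before the second `b`. Sliding it along the half-twisted `b` and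
    -- rotating turns `b v c b z` into `b v b z c`, which shortens the part between the two ends of
    -- `b`.
    have h1 : A.IsPartialWord S (c :: b :: (z ++ b :: v)) := by
      have : b :: (v ++ [c] ++ b :: z) = (b :: v) ++ (c :: b :: z) := by simp
      rw [this] at h
      simpa using h.rotate
    have h2 := h1.isWord.slide_twisted h.isSymm hcb hb
    have h3 := h1.slide hcS hbS h2
    have h4 : (A.slide c b).IsPartialWord S (b :: (v ++ b :: (z ++ [c]))) := by
      have : b :: (z ++ c :: b :: v) = (b :: (z ++ [c])) ++ (b :: v) := by simp
      rw [this] at h3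
      simpa using h3.rotate
    obtain ⟨A', z', hc, hw, hb'⟩ := ih _ h4 (by simp [slide_apply, hcb.symm, hb])
    exact ⟨A', z', (h1.slideConn hcb h3).trans hc, hw, hb'⟩

/-- Ends can be slid across an edge `a` without half twist. -/
theorem IsPartialWord.exists_commuted {S : Finset E} {a : E} (v X Y : List E)
    {A : Matrix E E (ZMod 2)} (h : A.IsPartialWord S (a :: (v ++ X ++ a :: Y)))
    (hd : ∀ e ∈ S, A e e = 0) :
    ∃ A', SlideConn A A' ∧ A'.IsPartialWord S (a :: (X ++ v ++ a :: Y)) ∧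
      ∀ e ∈ S, A' e e = 0 := by
  induction v generalizing A X with
  | nil => exact ⟨A, .refl, by simpa using h, hd⟩
  | cons c v ih =>
    have haS : a ∈ S := h.isWord.mem_of_mem (by simp)
    have hcS : c ∈ S := h.isWord.mem_of_mem (by simp)
    have hca : c ≠ a := by
      rintro rfl
      have := h.isWord.1 c
      simp [haS] at this
    -- Read backwards, `c` precedes an end of `a`. The slide carries it to the other end, turning `a
    -- c v X a Y` into `a v X c a Y`; repeating this rotates the segment between the two ends of
    -- `a`.
    have h1 : A.IsPartialWord S (c :: a :: (Y.reverse ++ a :: (v ++ X).reverse)) := by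
      have : a :: (c :: v ++ X ++ a :: Y) = (a :: c :: (v ++ X)) ++ (a :: Y) := by simp
      rw [this] at h
      have h' := h.rotate.reverse
      have : (a :: Y ++ a :: c :: (v ++ X)).reverse =
        (v ++ X).reverse ++ (c :: a :: (Y.reverse ++ [a])) := by simp
      rw [this] at h'
      simpa using h'.rotate
    have h3 := h1.slide hcS haS (h1.isWord.slide_untwisted h.isSymm hca (hd a haS))
    have h4 : (A.slide c a).IsPartialWord S (a :: (v ++ (X ++ [c]) ++ a :: Y)) := by
      have h' := h3.reverse
      have : (a :: (Y.reverse ++ a :: c :: (v ++ X).reverse)).reverse =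
        (v ++ X ++ [c] ++ a :: Y) ++ [a] := by simp
      rw [this] at h'
      simpa using h'.rotate
    obtain ⟨A', hc, hw, hd'⟩ := ih _ h4 (by
      intro e he
      have := h.isSymm.apply a c
      by_cases hec : e = c
      · subst hec
        simp [slide_apply, hd e he, hd a haS, this, CharTwo.add_self_eq_zero]
      · simp [slide_apply, hec, hd e he])
    exact ⟨A', (h1.slideConn hca h3).trans hc, by simpa using hw, hd'⟩

end Matrix

/-! ### Reduction of a graphic matrix to a matched one -/

namespace Matrix

variable {E : Type*} [DecidableEq E] [Fintype E]

theorem IsPartialWord.exists_matching {S : Finset E} {L : List E} {A : Matrix E E (ZMod 2)}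
    (h : A.IsPartialWord S L) : ∃ A', SlideConn A A' ∧ A'.IsSymm ∧ ∀ e, A'.IsMatchingRow e := by
  induction S using Finset.strongInduction generalizing A L with
  | H S ih =>
  have hmem : ∀ e ∈ S, e ∈ L := by
    intro e he
    rw [← List.count_pos_iff, h.isWord.1, if_pos he]
    norm_num
  have hne : ∀ p : ZMod 2, p ≠ 0 → p = 1 := by decide
  by_cases h1 : ∃ b ∈ S, A b b = 1
  · obtain ⟨b, hbS, hb⟩ := h1
    obtain ⟨u, w, rfl⟩ := List.append_of_mem (hmem b hbS)
    have hr := h.rotate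
    have hbm : b ∈ w ++ u := by
      have := hr.isWord.1 b
      rw [if_pos hbS, List.cons_append, List.count_cons_self] at this
      rw [← List.count_pos_iff]; omega
    obtain ⟨v, z, hvz⟩ := List.append_of_mem hbm
    have hr' : A.IsPartialWord S (b :: (v ++ b :: z)) := by
      rw [← hvz]; exact hr
    obtain ⟨A', z', hc, hw, hb'⟩ := hr'.exists_separated_loop v z hb
    have hzb : b ∉ z' := by
      rw [← List.count_eq_zero]
      have := hw.isWord.1 b
      simp [hbS] at this
      omega
    have hrow : ∀ f, f ≠ b → A' b f = 0 := by
      intro f hf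
      by_cases hfS : f ∈ S
      · rw [hw.isWord.2 b hbS f hfS hf.symm]
        simp [List.orderedPairs, List.orderedPairs_eq_zero (Or.inl hzb),
          hf.symm, CharTwo.add_self_eq_zero]
      · exact hw.isClosed b hbS f hfS
    obtain ⟨A'', hc', hA''⟩ := ih (S.erase b) (Finset.erase_ssubset hbS) (A := A') (L := z')
      { isSymm := hw.isSymm
        isWord := by
          refine ⟨fun e => ?_, fun e he f hf hef => ?_⟩
          · have := hw.isWord.1 e
            rcases eq_or_ne e b with rfl | heb
            · rw [List.count_eq_zero.mpr hzb]; simp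
            · simpa [List.count_cons, heb, heb.symm] using this
          · rw [Finset.mem_erase] at he hf
            rw [hw.isWord.2 e he.2 f hf.2 hef]
            simp [List.orderedPairs, he.1.symm]
        isClosed := by
          intro e he f hf
          rw [Finset.mem_erase] at he hf
          rcases eq_or_ne f b with rfl | hfb
          · rw [← hw.isSymm.apply]; exact hrow e he.1
          · exact hw.isClosed e he.2 f (by tauto)
        matching := by
          intro e he f g hf hg
          rcases eq_or_ne e b with rfl | heb
          · have h1 : f = e := by by_contra hn; exact hf (hrow f hn)
            have h2 : g = e := by by_contra hn; exact hg (hrow g hn)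
            rw [h1, h2]
          · exact hw.matching e (fun h => he (Finset.mem_erase.mpr ⟨heb, h⟩)) f g hf hg }
    exact ⟨A'', hc.trans hc', hA''⟩
  have hd : ∀ e ∈ S, A e e = 0 := by
    intro e he
    by_contra hn
    exact h1 ⟨e, he, hne _ hn⟩
  by_cases h2 : ∃ a ∈ S, ∃ b ∈ S, A a b = 1
  · obtain ⟨a, haS, b, hbS, hab⟩ := h2
    have hne' : a ≠ b := by
      rintro rfl
      rw [hd a haS] at hab
      exact absurd hab (by decide)
    obtain ⟨u, w, rfl⟩ := List.append_of_mem (hmem a haS)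
    have hr := h.rotate
    have ham : a ∈ w ++ u := by
      have := hr.isWord.1 a
      rw [if_pos haS, List.cons_append, List.count_cons_self] at this
      rw [← List.count_pos_iff]; omega
    obtain ⟨X, Y, hXY⟩ := List.append_of_mem ham
    have hr' : A.IsPartialWord S (a :: (X ++ a :: Y)) := by
      rw [← hXY]; exact hr
    have hcount : X.count b = 1 ∧ Y.count b = 1 := by
      have hca := hr'.isWord.1 a
      simp [haS] at hca
      have haX : a ∉ X := by rw [← List.count_eq_zero]; omega
      have haY : a ∉ Y := by rw [← List.count_eq_zero]; omega
      have hcb := hr'.isWord.1 b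
      simp [hbS, hne'] at hcb
      have := hr'.isWord.2 a haS b hbS hne'
      rw [hab] at this
      simp [List.orderedPairs, List.orderedPairs_append, hne',
        List.orderedPairs_eq_zero (Or.inl haX), List.orderedPairs_eq_zero (Or.inl haY),
        List.count_eq_zero.mpr haX, add_assoc, CharTwo.add_self_eq_zero] at this
      have h0 : X.count b ≠ 0 := by
        intro h0; rw [h0] at this; exact absurd this (by decide)
      have h2 : X.count b ≠ 2 := by
        intro h0; rw [h0] at this; exact absurd this (by decide)
      omega
    obtain ⟨v, s, rfl⟩ := List.append_of_mem (List.count_pos_iff.mp (by omega : 0 < X.count b))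
    obtain ⟨t, z, rfl⟩ := List.append_of_mem (List.count_pos_iff.mp (by omega : 0 < Y.count b))
    -- Up to cyclic rotation the word passes from `a v b s a t b z` to `a b s v a t b z`, then to `b
    -- a t s v b z a`, and then to `a b z t s v a b`, which is `a b a b` followed by the other
    -- letters.
    obtain ⟨A₁, hc₁, hw₁, hd₁⟩ := hr'.exists_commuted v (b :: s) (t ++ b :: z) hd
    have hw₁' : A₁.IsPartialWord S (b :: ((s ++ v) ++ (a :: t) ++ b :: (z ++ [a]))) := by
      have h' := hw₁.rotate (L := [a])
      simpa using h'
    obtain ⟨A₂, hc₂, hw₂, hd₂⟩ := hw₁'.exists_commuted _ _ _ hd₁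
    have hw₂' : A₂.IsPartialWord S (a :: ((t ++ (s ++ v)) ++ (b :: z) ++ a :: [b])) := by
      have h' := hw₂.rotate (L := [b])
      simpa using h'
    obtain ⟨A₃, hc₃, hw₃, hd₃⟩ := hw₂'.exists_commuted _ _ _ hd₂
    generalize t ++ (s ++ v) = t' at hw₃
    have hw : A₃.IsPartialWord S (a :: b :: a :: b :: (z ++ t')) := by
      have h' := hw₃.rotate (L := (a :: (b :: z ++ t'))) (M := [a, b])
      simpa using h'
    generalize z ++ t' = z' at hw
    have hza : a ∉ z' := by
      rw [← List.count_eq_zero]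
      have := hw.isWord.1 a
      simp [haS, hne'.symm] at this
      omega
    have hzb : b ∉ z' := by
      rw [← List.count_eq_zero]
      have := hw.isWord.1 b
      simp [hbS, hne'] at this
      omega
    have hrowa : ∀ f, f ≠ b → A₃ a f = 0 := by
      intro f hf
      rcases eq_or_ne f a with rfl | hfa
      · exact hd₃ _ haS
      by_cases hfS : f ∈ S
      · rw [hw.isWord.2 a haS f hfS hfa.symm]
        simp [List.orderedPairs, List.orderedPairs_eq_zero (Or.inl hza),
          hf.symm, hfa.symm, hne'.symm, CharTwo.add_self_eq_zero]
      · exact hw.isClosed a haS f hfS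
    have hrowb : ∀ f, f ≠ a → A₃ b f = 0 := by
      intro f hf
      rcases eq_or_ne f b with rfl | hfb
      · exact hd₃ _ hbS
      by_cases hfS : f ∈ S
      · rw [hw.isWord.2 b hbS f hfS hfb.symm]
        simp [List.orderedPairs, List.orderedPairs_eq_zero (Or.inl hzb),
          hf.symm, hfb.symm, hne', CharTwo.add_self_eq_zero]
      · exact hw.isClosed b hbS f hfS
    have hss : (S.erase a).erase b ⊂ S :=
      (Finset.erase_subset _ _).trans_ssubset (Finset.erase_ssubset haS)
    obtain ⟨A'', hc', hA''⟩ := ih ((S.erase a).erase b) hss (A := A₃) (L := z')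
      { isSymm := hw.isSymm
        isWord := by
          refine ⟨fun e => ?_, fun e he f hf hef => ?_⟩
          · have := hw.isWord.1 e
            rcases eq_or_ne e a with rfl | hea
            · rw [List.count_eq_zero.mpr hza]; simp
            rcases eq_or_ne e b with rfl | heb
            · rw [List.count_eq_zero.mpr hzb]; simp
            · simpa [List.count_cons, heb, heb.symm, hea, hea.symm] using this
          · simp only [Finset.mem_erase] at he hf
            rw [hw.isWord.2 e he.2.2 f hf.2.2 hef]
            simp [List.orderedPairs, he.1.symm, he.2.1.symm]
        isClosed := by
          intro e he f hf
          simp only [Finset.mem_erase] at he hf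
          rcases eq_or_ne f b with rfl | hfb
          · rw [← hw.isSymm.apply]; exact hrowb e he.2.1
          rcases eq_or_ne f a with rfl | hfa
          · rw [← hw.isSymm.apply]; exact hrowa e he.1
          · exact hw.isClosed e he.2.2 f (by tauto)
        matching := by
          intro e he f g hf hg
          rcases eq_or_ne e b with rfl | heb
          · have h1 : f = a := by by_contra hn; exact hf (hrowb f hn)
            have h2 : g = a := by by_contra hn; exact hg (hrowb g hn)
            rw [h1, h2]
          rcases eq_or_ne e a with rfl | hea
          · have h1 : f = b := by by_contra hn; exact hf (hrowa f hn)
            have h2 : g = b := by by_contra hn; exact hg (hrowa g hn)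
            rw [h1, h2]
          · exact hw.matching e (fun h => he (by simp [heb, hea, h])) f g hf hg }
    exact ⟨A'', ((hc₁.trans hc₂).trans hc₃).trans hc', hA''⟩
  · refine ⟨A, .refl, h.isSymm, fun e f g hf hg => ?_⟩
    by_cases he : e ∈ S
    · exfalso
      by_cases hfS : f ∈ S
      · exact h2 ⟨e, he, f, hfS, hne _ hf⟩
      · exact hf (h.isClosed e he f hfS)
    · exact h.matching e he f g hf hg

theorem IsGraphic.exists_matching {A : Matrix E E (ZMod 2)} (h : A.IsGraphic) :
    ∃ A', SlideConn A A' ∧ A'.IsSymm ∧ ∀ e, A'.IsMatchingRow e := by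
  obtain ⟨hs, L, hL⟩ := h
  exact IsPartialWord.exists_matching (S := Finset.univ) (L := L)
    ⟨hs, hL, fun _ _ f hf => absurd (Finset.mem_univ f) hf,
      fun e he => absurd (Finset.mem_univ e) he⟩

end Matrix

/-! ### Relabelling and diagonalising matched matrices by slides -/

namespace Matrix

variable {E : Type*} [DecidableEq E]

theorem _root_.List.orderedPairs_add_swap (L : List E) {e f : E} (h : e ≠ f) :
    L.orderedPairs e f + L.orderedPairs f e = L.count e * L.count f := by
  induction L with
  | nil => simp [List.orderedPairs]
  | cons g L ih =>
    simp only [List.orderedPairs, List.count_cons, beq_iff_eq, Nat.cast_add, Nat.cast_ite,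
      Nat.cast_one, Nat.cast_zero]
    split_ifs with h1 h2
    · exact absurd (h1.symm.trans h2) h
    · linear_combination ih
    · linear_combination ih
    · linear_combination ih

theorem isWord_triple {A : Matrix E E (ZMod 2)} (hA : A.IsSymm) {a b c : E} {L : List E}
    (hL : ∀ e, L.count e = if e ∈ ({a, b, c} : Finset E) then 2 else 0)
    (hab : A a b = L.orderedPairs a b) (hac : A a c = L.orderedPairs a c)
    (hbc : A b c = L.orderedPairs b c) : A.IsWord {a, b, c} L := by
  have hsymm : ∀ e f, e ≠ f → L.orderedPairs e f = L.orderedPairs f e := by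
    intro e f hef
    rw [← CharTwo.add_eq_zero, L.orderedPairs_add_swap hef, hL e]
    split_ifs
    · exact zero_mul _
    · exact zero_mul _
  refine ⟨hL, fun e he f hf hef => ?_⟩
  simp only [Finset.mem_insert, Finset.mem_singleton] at he hf
  rcases he with rfl | rfl | rfl <;> rcases hf with rfl | rfl | rfl <;>
    first
    | exact absurd rfl hef
    | assumption
    | (rw [hsymm _ _ hef, hA.apply]; assumption)

/-- After the slide the end of `a` is adjacent to the other end of `b`. Rotation, preceded by
reversal when `b` is untwisted, brings `a b` to the front again, so slides can be iterated. -/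
theorem IsWord.slide_head {A : Matrix E E (ZMod 2)} {S : Finset E} {a b : E} {R : List E}
    (hA : A.IsSymm) (hab : a ≠ b) (h : A.IsWord S (a :: b :: R)) :
    ∃ R', (A.slide a b).IsWord S (a :: b :: R') := by
  have hbR : b ∈ R := by
    have := h.1 b
    rw [if_pos (h.mem_of_mem (by simp)), List.count_cons_of_ne hab, List.count_cons_self] at this
    rw [← List.count_pos_iff]; omega
  obtain ⟨v, z, rfl⟩ := List.append_of_mem hbR
  rcases (by decide : ∀ p : ZMod 2, p = 0 ∨ p = 1) (A b b) with hb | hb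
  · have h1 := (h.slide_untwisted hA hab hb).reverse (hA.slide a b)
    have h2 : (b :: (v ++ b :: a :: z)).reverse = z.reverse ++ (a :: b :: (v.reverse ++ [b])) := by
      simp
    rw [h2] at h1
    exact ⟨_, h1.rotate⟩
  · have h1 := h.slide_twisted hA hab hb
    rw [← List.cons_append] at h1
    exact ⟨_, h1.rotate⟩

theorem IsWord.swap_head {A : Matrix E E (ZMod 2)} {S : Finset E} {a b : E} {R : List E}
    (hA : A.IsSymm) (h : A.IsWord S (a :: b :: R)) : ∃ R', A.IsWord S (b :: a :: R') := by
  have h1 := h.reverse hA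
  have h2 : (a :: b :: R).reverse = R.reverse ++ [b, a] := by simp
  rw [h2] at h1
  exact ⟨_, h1.rotate⟩

/-- Within one block `b a b a`, a rotation suffices. Otherwise a block word ending in `a` is
followed by a block word rotated to start with `b`. -/
theorem exists_isWord_adjacent [Fintype E] {A : Matrix E E (ZMod 2)} (hA : A.IsSymm)
    (hm : ∀ e, A.IsMatchingRow e) {a b : E} (hab : a ≠ b) :
    ∃ R, A.IsWord Finset.univ (a :: b :: R) := by
  have huniv : A.IsClosed (Finset.univ : Finset E) := fun _ _ f hf => absurd (Finset.mem_univ f) hf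
  obtain ⟨T, l, haT, -, hl, hT, hTa⟩ := exists_block hA huniv (fun e _ => hm e) (Finset.mem_univ a)
  have hU := huniv.sdiff hA hT
  by_cases hbT : b ∈ T
  · obtain ⟨l', rfl⟩ := (hTa b hbT).resolve_left hab.symm
    obtain ⟨M, hM⟩ := exists_isWord hA (Finset.univ \ T) hU (fun e _ => hm e)
    have h2 := hl.rotate.append hM hA Finset.disjoint_sdiff
      (fun e he f hf => hT e he f (Finset.mem_sdiff.mp hf).2)
    rw [Finset.union_sdiff_of_subset (Finset.subset_univ T)] at h2
    exact ⟨_, h2⟩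
  · obtain ⟨U, m, hbU, hUT, hm', hU', -⟩ := exists_block hA hU (fun e _ => hm e)
      (Finset.mem_sdiff.mpr ⟨Finset.mem_univ b, hbT⟩)
    obtain ⟨M, hM⟩ := exists_isWord hA ((Finset.univ \ T) \ U) (hU.sdiff hA hU') (fun e _ => hm e)
    have h1 := hm'.rotate.append hM hA Finset.disjoint_sdiff
      (fun e he f hf => hU' e he f (Finset.mem_sdiff.mp hf).2)
    rw [Finset.union_sdiff_of_subset hUT] at h1
    have h2 := hl.append h1 hA Finset.disjoint_sdiff
      (fun e he f hf => hT e he f (Finset.mem_sdiff.mp hf).2)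
    rw [Finset.union_sdiff_of_subset (Finset.subset_univ T), List.append_assoc] at h2
    have h3 := h2.rotate
    exact ⟨_, by simpa using h3⟩

variable [Fintype E]

/-- Exchanging the labels of two edges with adjacent ends. -/
theorem IsWord.slideConn_swap {A : Matrix E E (ZMod 2)} (hA : A.IsSymm) {a b : E} (hab : a ≠ b)
    {R : List E} (h : A.IsWord Finset.univ (a :: b :: R)) :
    SlideConn A (A.submatrix (Equiv.swap a b) (Equiv.swap a b)) := by
  obtain ⟨R₁, h₁⟩ := h.slide_head hA hab
  have hA₁ := hA.slide a b
  obtain ⟨R₂, h₂⟩ := h₁.swap_head hA₁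
  obtain ⟨R₃, h₃⟩ := h₂.slide_head hA₁ hab.symm
  have hA₂ := hA₁.slide b a
  obtain ⟨R₄, h₄⟩ := h₃.swap_head hA₂
  obtain ⟨R₅, h₅⟩ := h₄.slide_head hA₂ hab
  have hA₃ := hA₂.slide a b
  rw [← slide_slide_slide A hab]
  exact .head ⟨⟨hA, _, h⟩, ⟨hA₁, _, h₁⟩, a, b, hab, rfl⟩
    (.head ⟨⟨hA₁, _, h₁⟩, ⟨hA₂, _, h₃⟩, b, a, hab.symm, rfl⟩
      (.single ⟨⟨hA₂, _, h₃⟩, ⟨hA₃, _, h₅⟩, a, b, hab, rfl⟩))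

/-- Swaps generate the permutations, and a relabelled matched matrix is again matched, so at each
swap a word with the two letters adjacent is available. -/
theorem slideConn_submatrix (σ : Equiv.Perm E) {A : Matrix E E (ZMod 2)} (hA : A.IsSymm)
    (hm : ∀ e, A.IsMatchingRow e) : SlideConn A (A.submatrix σ σ) := by
  induction σ using Equiv.Perm.swap_induction_on generalizing A with
  | one => exact .refl
  | swap_mul f x y hxy ih =>
    obtain ⟨R, hR⟩ := exists_isWord_adjacent hA hm hxy
    refine (hR.slideConn_swap hA hxy).trans (ih (hA.submatrix _) ?_)
    intro e g k hg hk
    exact (Equiv.swap x y).injective (hm _ _ _ hg hk)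

/-- A matched pair next to a half-twisted loop can be replaced by two half-twisted loops. -/
theorem exists_slideConn_diagonal_triple {A : Matrix E E (ZMod 2)} (hA : A.IsSymm)
    (hm : ∀ e, A.IsMatchingRow e) {a b c : E} (hab : a ≠ b) (h1 : A a b ≠ 0) (hc : A c c ≠ 0) :
    ∃ A', SlideConn A A' ∧ A'.IsSymm ∧ (∀ e, A'.IsMatchingRow e) ∧ A' a a ≠ 0 ∧
      ∀ e, A e e ≠ 0 → A' e e ≠ 0 := by
  have h1' : A b a ≠ 0 := by rwa [hA.apply]
  have hac : a ≠ c := by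
    rintro rfl; exact hab (hm _ _ _ hc h1)
  have hbc : b ≠ c := by
    rintro rfl; exact hab (hm _ _ _ h1' hc)
  have hA1 : ∀ f, f ≠ b → A a f = 0 := fun f hf => by
    by_contra hn; exact hf (hm _ _ _ hn h1)
  have hA2 : ∀ f, f ≠ a → A b f = 0 := fun f hf => by
    by_contra hn; exact hf (hm _ _ _ hn h1')
  have hA3 : ∀ f, f ≠ c → A c f = 0 := fun f hf => by
    by_contra hn; exact hf (hm _ _ _ hn hc)
  have eaa := hA1 a hab
  have eac := hA1 c hbc.symm
  have ebb := hA2 b hab.symm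
  have ebc := hA2 c hac.symm
  have eca := hA3 a hac
  have ecb := hA3 b hbc
  have eab := eq_one_of_ne_zero h1
  have eba := eq_one_of_ne_zero h1'
  have ecc := eq_one_of_ne_zero hc
  have hcount : ∀ {L : List E}, L.Perm [a, b, c, a, b, c] → ∀ e,
      L.count e = if e ∈ ({a, b, c} : Finset E) then 2 else 0 := by
    intro L hL e
    rw [hL.count_eq]
    simp only [List.count_cons, List.count_nil, beq_iff_eq, Finset.mem_insert,
      Finset.mem_singleton]
    grind
  have p₀ : [b, a, b, a, c, c].Perm [a, b, c, a, b, c] := by grind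
  have p₁ : [b, a, b, c, a, c].Perm [a, b, c, a, b, c] := by grind
  have p₂ : [b, a, c, a, b, c].Perm [a, b, c, a, b, c] := by grind
  have p₃ : [a, a, b, c, b, c].Perm [a, b, c, a, b, c] := by grind
  have p₄ : [a, a, b, b, c, c].Perm [a, b, c, a, b, c] := by grind
  have h2 : (2 : ZMod 2) = 0 := rfl
  have hba := hab.symm
  have hca := hac.symm
  have hcb := hbc.symm
  have w₀ : A.IsPartialWord {a, b, c} [b, a, b, a, c, c] :=
    { isSymm := hA
      isWord := by
        refine isWord_triple hA (hcount p₀) ?_ ?_ ?_ <;>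
          simp [List.orderedPairs, eab, eac, ebc, hab, hba, hac, hca, hbc, hcb, h2]
      isClosed := by
        intro e he f hf
        simp only [Finset.mem_insert, Finset.mem_singleton, not_or] at he hf
        rcases he with rfl | rfl | rfl
        · exact hA1 f hf.2.1
        · exact hA2 f hf.1
        · exact hA3 f hf.2.2
      matching := fun e _ => hm e }
  have ha : a ∈ ({a, b, c} : Finset E) := by simp
  have hb : b ∈ ({a, b, c} : Finset E) := by simp
  have hc' : c ∈ ({a, b, c} : Finset E) := by simp
  -- In terms of the bilinear form, `a + c` and `b + c` are orthonormal, and adding both to `c`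
  -- makes it orthogonal to them. The displayed words show that each intermediate matrix is graphic.
  have w₁ : (A.slide a c).IsPartialWord {a, b, c} [b, a, b, c, a, c] := by
    refine w₀.slide ha hc' (isWord_triple (w₀.isSymm.slide _ _) (hcount p₁) ?_ ?_ ?_) <;>
      simp [List.orderedPairs, slide_apply, eab, eac, ebc, ecb, ecc, hab, hba, hac, hca, hbc, hcb,
        h2]
  have w₂ : ((A.slide a c).slide b c).IsPartialWord {a, b, c} [b, a, c, a, b, c] := by
    refine w₁.slide hb hc' (isWord_triple (w₁.isSymm.slide _ _) (hcount p₂) ?_ ?_ ?_) <;>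
      simp [List.orderedPairs, slide_apply, eab, eac, ebc, ecb, ecc, hab, hba, hac, hca, hbc, hcb,
        h2]
  have w₃ : (((A.slide a c).slide b c).slide c a).IsPartialWord {a, b, c} [a, a, b, c, b, c] := by
    refine w₂.slide hc' ha (isWord_triple (w₂.isSymm.slide _ _) (hcount p₃) ?_ ?_ ?_) <;>
      simp [List.orderedPairs, slide_apply, eaa, eab, eac, eba, ebc, eca, ecb, ecc, hab, hba, hac,
        hca, hbc, hcb, h2, CharTwo.add_self_eq_zero]
  have w₄ : ((((A.slide a c).slide b c).slide c a).slide c b).IsPartialWord {a, b, c}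
      [a, a, b, b, c, c] := by
    refine w₃.slide hc' hb (isWord_triple (w₃.isSymm.slide _ _) (hcount p₄) ?_ ?_ ?_) <;>
      simp [List.orderedPairs, slide_apply, eaa, eab, eac, eba, ebb, ebc, eca, ecb, ecc, hab, hba,
        hac, hca, hbc, hcb, h2, CharTwo.add_self_eq_zero]
  have hdiag : ∀ e ∈ ({a, b, c} : Finset E),
      ((((A.slide a c).slide b c).slide c a).slide c b) e e ≠ 0 := by
    intro e he
    simp only [Finset.mem_insert, Finset.mem_singleton] at he
    rcases he with rfl | rfl | rfl <;>
      simp [slide_apply, eaa, eab, eac, eba, ebb, ebc, eca, ecb, ecc, hab, hba, hac, hca, hbc, hcb,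
        CharTwo.add_self_eq_zero]
  refine ⟨_, (w₀.slideConn hac w₁).trans ((w₁.slideConn hbc w₂).trans
    ((w₂.slideConn hca w₃).trans (w₃.slideConn hcb w₄))), w₄.isSymm, fun e => ?_, hdiag a ha,
    fun e he => ?_⟩
  · by_cases heS : e ∈ ({a, b, c} : Finset E)
    · have hrow : ∀ f, ((((A.slide a c).slide b c).slide c a).slide c b) e f ≠ 0 → f = e := by
        intro f hf
        by_contra hfe
        by_cases hfS : f ∈ ({a, b, c} : Finset E)
        · rw [w₄.isWord.2 e heS f hfS (Ne.symm hfe)] at hf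
          simp only [Finset.mem_insert, Finset.mem_singleton] at heS hfS
          rcases heS with rfl | rfl | rfl <;> rcases hfS with rfl | rfl | rfl <;>
            simp [List.orderedPairs, hab, hba, hac, hca, hbc, hcb, h2,
              CharTwo.add_self_eq_zero] at hf hfe
        · exact hf (w₄.isClosed e heS f hfS)
      intro f g hf hg
      rw [hrow f hf, hrow g hg]
    · exact w₄.matching e heS
  · by_cases heS : e ∈ ({a, b, c} : Finset E)
    · exact hdiag e heS
    · simp only [Finset.mem_insert, Finset.mem_singleton, not_or] at heS
      simpa [slide_apply, heS.1, heS.2.1, heS.2.2] using he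

/-- Each application of `exists_slideConn_diagonal_triple` makes the diagonal entry at `a` nonzero
and destroys no nonzero diagonal entry, so the number of zero diagonal entries decreases. -/
theorem exists_slideConn_diagonal {A : Matrix E E (ZMod 2)} (hA : A.IsSymm)
    (hm : ∀ e, A.IsMatchingRow e) (hd : ∃ c, A c c ≠ 0) :
    ∃ A', SlideConn A A' ∧ ∀ e f, e ≠ f → A' e f = 0 := by
  obtain ⟨n, hn⟩ : ∃ n, n = (Finset.univ.filter fun e => A e e = 0).card := ⟨_, rfl⟩
  induction n using Nat.strong_induction_on generalizing A with
  | _ n ih =>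
  by_cases h : ∃ a b, a ≠ b ∧ A a b ≠ 0
  · obtain ⟨a, b, hab, h1⟩ := h
    obtain ⟨c, hc⟩ := hd
    obtain ⟨A', hc', hs, hm', ha, hdiag⟩ := exists_slideConn_diagonal_triple hA hm hab h1 hc
    have ha0 : A a a = 0 := by
      by_contra hn; exact hab (hm _ _ _ hn h1)
    have hlt : (Finset.univ.filter fun e => A' e e = 0).card < n := by
      rw [hn]
      refine Finset.card_lt_card ⟨fun e he => ?_, fun hsub => ?_⟩
      · simp only [Finset.mem_filter, Finset.mem_univ, true_and] at he ⊢
        by_contra hn; exact hdiag e hn he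
      · have := hsub (Finset.mem_filter.mpr ⟨Finset.mem_univ a, ha0⟩)
        exact ha (Finset.mem_filter.mp this).2
    obtain ⟨A'', hc'', hA''⟩ := ih _ hlt hs hm' ⟨c, hdiag c hc⟩ rfl
    exact ⟨A'', hc'.trans hc'', hA''⟩
  · push Not at h
    exact ⟨A, .refl, h⟩

end Matrix

/-! ### Congruence invariants and the comparison of matched matrices -/

namespace Matrix

variable {E : Type*}

theorem IsSymm.slide_diag_eq_zero [DecidableEq E] {A : Matrix E E (ZMod 2)} (hA : A.IsSymm)
    (hd : ∀ e, A e e = 0) (a b : E) (e : E) : A.slide a b e e = 0 := by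
  have := hA.apply a b
  rcases eq_or_ne e a with rfl | h
  · simp [slide_apply, hd, this, CharTwo.add_self_eq_zero]
  · simp [slide_apply, hd, h]

variable [Fintype E]

/-- The involutive substitution of `slide_mulVec` is a bijection between the two kernels. -/
theorem card_ker_slide [DecidableEq E] (A : Matrix E E (ZMod 2)) {a b : E} (hab : a ≠ b) :
    Nat.card {x : E → ZMod 2 // A.slide a b *ᵥ x = 0} =
      Nat.card {x : E → ZMod 2 // A *ᵥ x = 0} := by
  have hinv : Function.Involutive fun y : E → ZMod 2 => y + Pi.single b (y a) := by
    intro y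
    have h : (y + Pi.single b (y a) : E → ZMod 2) a = y a := by simp [hab]
    funext e
    simp only [Pi.add_apply] at h ⊢
    rw [h, add_assoc, CharTwo.add_self_eq_zero, add_zero]
  refine Nat.card_congr (Equiv.subtypeEquiv (hinv.toPerm _) fun y => ?_)
  have hcoe : hinv.toPerm _ y = y + Pi.single b (y a) := rfl
  rw [hcoe]
  constructor
  · intro h
    have hb : (A *ᵥ (y + Pi.single b (y a))) b = 0 := by
      have := congrFun h b
      rwa [slide_mulVec, if_neg hab.symm, add_zero] at this
    funext e
    have := congrFun h e
    rwa [slide_mulVec, hb, ite_self, add_zero] at this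
  · intro h
    funext e
    rw [slide_mulVec, h]
    simp

theorem mulVec_apply_of_isMatchingRow {A : Matrix E E (ZMod 2)} {e f : E}
    (hm : A.IsMatchingRow e) (h : A e f ≠ 0) (x : E → ZMod 2) : (A *ᵥ x) e = x f := by
  classical
  rw [mulVec, dotProduct, Finset.sum_eq_single f, eq_one_of_ne_zero h, one_mul]
  · intro g _ hg
    have : A e g = 0 := by
      by_contra hn
      exact hg (hm _ _ hn h)
    rw [this, zero_mul]
  · intro hf; exact absurd (Finset.mem_univ f) hf

/-- Multiplication by a matched matrix permutes the coordinates with nonzero rows and kills the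
others, so a kernel vector is zero at the former and arbitrary at the latter. -/
theorem card_ker_of_isMatchingRow {A : Matrix E E (ZMod 2)} (hA : A.IsSymm)
    (hm : ∀ e, A.IsMatchingRow e) :
    Nat.card {x : E → ZMod 2 // A *ᵥ x = 0} = 2 ^ Nat.card {e // ∀ f, A e f = 0} := by
  classical
  have hker : ∀ x : E → ZMod 2, A *ᵥ x = 0 ↔ ∀ e, ¬ (∀ f, A e f = 0) → x e = 0 := by
    intro x
    constructor
    · intro h e he
      push Not at he
      obtain ⟨f, hf⟩ := he
      rw [← hA.apply] at hf
      rw [← mulVec_apply_of_isMatchingRow (hm f) hf x, h, Pi.zero_apply]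
    · intro h
      funext e
      by_cases he : ∀ f, A e f = 0
      · simp [mulVec, dotProduct, he]
      · push Not at he
        obtain ⟨f, hf⟩ := he
        rw [mulVec_apply_of_isMatchingRow (hm e) hf, Pi.zero_apply]
        refine h f fun h0 => hf ?_
        rw [← hA.apply]; exact h0 e
  let φ : {x : E → ZMod 2 // A *ᵥ x = 0} ≃ ({e // ∀ f, A e f = 0} → ZMod 2) :=
    { toFun := fun x e => x.1 e.1
      invFun := fun y => ⟨fun e => if h : ∀ f, A e f = 0 then y ⟨e, h⟩ else 0,
        (hker _).mpr fun e he => dif_neg he⟩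
      left_inv := by
        intro x
        ext e
        by_cases h : ∀ f, A e f = 0
        · simp only [dif_pos h]
        · simp only [dif_neg h]
          exact ((hker _).mp x.2 e h).symm
      right_inv := by
        intro y
        funext e
        simp only [dif_pos e.2] }
  rw [Nat.card_congr φ, Nat.card_fun, Nat.card_zmod]

/-- Two matched matrices with zero diagonal and equally many zero rows differ by a permutation. -/
theorem exists_perm_of_alternating [DecidableEq E] {A C : Matrix E E (ZMod 2)} (hA : A.IsSymm)
    (hmA : ∀ e, A.IsMatchingRow e) (hdA : ∀ e, A e e = 0) (hC : C.IsSymm)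
    (hmC : ∀ e, C.IsMatchingRow e) (hdC : ∀ e, C e e = 0)
    (hcard : Nat.card {e // ∀ f, A e f = 0} = Nat.card {e // ∀ f, C e f = 0}) :
    ∃ σ : Equiv.Perm E, A.submatrix σ σ = C := by
  have key : ∀ B : Matrix E E (ZMod 2), B.IsSymm → (∀ e, B.IsMatchingRow e) → (∀ e, B e e = 0) →
      ∃ τ : Equiv.Perm E, τ ^ 2 = 1 ∧ (∀ e f, B e f ≠ 0 ↔ τ e = f ∧ e ≠ f) ∧
        τ.support.card + Nat.card {e // ∀ f, B e f = 0} = Fintype.card E := by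
    intro B hB hm hd
    classical
    -- Zero rows are sent to themselves. As the diagonal vanishes, these are all the fixed points,
    -- and the involution encodes the matrix.
    let t : E → E := fun e => if h : ∃ f, B e f ≠ 0 then h.choose else e
    have ht : ∀ e f, B e f ≠ 0 → t e = f := by
      intro e f h
      have h' : ∃ f, B e f ≠ 0 := ⟨f, h⟩
      have : t e = h'.choose := dif_pos h'
      rw [this]
      exact hm e _ _ h'.choose_spec h
    have ht' : ∀ e, (∀ f, B e f = 0) → t e = e := by
      intro e h
      exact dif_neg (by push Not; exact h)
    have hinv : Function.Involutive t := by
      intro e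
      by_cases h : ∃ f, B e f ≠ 0
      · obtain ⟨f, hf⟩ := h
        rw [ht e f hf, ht f e (by rwa [hB.apply])]
      · push Not at h
        rw [ht' e h, ht' e h]
    have hiff : ∀ e f, B e f ≠ 0 ↔ t e = f ∧ e ≠ f := by
      intro e f
      constructor
      · intro h
        refine ⟨ht e f h, ?_⟩
        rintro rfl
        exact h (hd e)
      · rintro ⟨h, hne⟩
        by_cases h0 : ∃ g, B e g ≠ 0
        · obtain ⟨g, hg⟩ := h0
          rw [← h, ht e g hg]; exact hg
        · push Not at h0
          exact absurd ((ht' e h0).symm.trans h) hne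
    refine ⟨hinv.toPerm, ?_, hiff, ?_⟩
    · ext e
      rw [pow_two]
      exact hinv e
    · have : Nat.card {e // ∀ f, B e f = 0} = (hinv.toPerm.support)ᶜ.card := by
        rw [Nat.card_eq_fintype_card, Fintype.card_subtype]
        congr 1
        ext e
        simp only [Finset.mem_filter, Finset.mem_univ, true_and, Finset.mem_compl,
          Equiv.Perm.mem_support, not_not, Function.Involutive.coe_toPerm]
        refine ⟨ht' e, fun h f => ?_⟩
        by_contra hn
        exact ((hiff e f).mp hn).2 (h.symm.trans ((hiff e f).mp hn).1)
      rw [this, Finset.card_compl]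
      have := Finset.card_le_univ (hinv.toPerm.support)
      omega
  obtain ⟨τ, hτ2, hτ, hτc⟩ := key A hA hmA hdA
  obtain ⟨ρ, hρ2, hρ, hρc⟩ := key C hC hmC hdC
  have : IsConj ρ τ := by
    have hs : τ.support.card = ρ.support.card := by omega
    -- The cycle type of an involution consists of twos only, so the size of the support determines
    -- it.
    rw [Equiv.Perm.isConj_iff_cycleType_eq]
    have h1 := Equiv.Perm.cycleType_of_pow_prime_eq_one (p := 2) hτ2
    have h2 := Equiv.Perm.cycleType_of_pow_prime_eq_one (p := 2) hρ2
    rw [← Equiv.Perm.sum_cycleType, ← Equiv.Perm.sum_cycleType, h1, h2, Multiset.sum_replicate,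
      Multiset.sum_replicate, smul_eq_mul, smul_eq_mul] at hs
    rw [h1, h2, Nat.eq_of_mul_eq_mul_right (by norm_num) hs]
  obtain ⟨σ, hσ⟩ := isConj_iff.mp this
  refine ⟨σ, ?_⟩
  ext e f
  have hiff : A (σ e) (σ f) ≠ 0 ↔ C e f ≠ 0 := by
    rw [hτ, hρ, ← hσ]
    simp
  rw [submatrix_apply]
  generalize A (σ e) (σ f) = p at hiff
  generalize C e f = q at hiff
  revert p q; decide

/-- Two diagonal matrices with equally many zero rows differ by a permutation. -/
theorem exists_perm_of_diagonal [DecidableEq E] {A C : Matrix E E (ZMod 2)}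
    (hA : ∀ e f, e ≠ f → A e f = 0) (hC : ∀ e f, e ≠ f → C e f = 0)
    (hcard : Nat.card {e // ∀ f, A e f = 0} = Nat.card {e // ∀ f, C e f = 0}) :
    ∃ σ : Equiv.Perm E, A.submatrix σ σ = C := by
  classical
  have hrow : ∀ B : Matrix E E (ZMod 2), (∀ e f, e ≠ f → B e f = 0) → ∀ e,
      (∀ f, B e f = 0) ↔ B e e = 0 := by
    intro B hB e
    refine ⟨fun h => h e, fun h f => ?_⟩
    rcases eq_or_ne e f with rfl | hef
    · exact h
    · exact hB e f hef
  have g : {e // ∀ f, C e f = 0} ≃ {e // ∀ f, A e f = 0} :=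
    Fintype.equivOfCardEq (by rw [← Nat.card_eq_fintype_card, ← Nat.card_eq_fintype_card, hcard])
  refine ⟨g.extendSubtype, ?_⟩
  ext e f
  rw [submatrix_apply]
  rcases eq_or_ne e f with rfl | hef
  · have h1 : A (g.extendSubtype e) (g.extendSubtype e) = 0 ↔ C e e = 0 := by
      rw [← hrow A hA, ← hrow C hC]
      refine ⟨fun h => ?_, fun h => g.extendSubtype_mem e h⟩
      by_contra hn
      exact g.extendSubtype_not_mem e hn h
    generalize A _ _ = p at *
    generalize C e e = q at *
    revert p q; decide
  · rw [hC e f hef, hA _ _ (g.extendSubtype.injective.ne hef)]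

/-- Elementary congruences without restriction on the intermediate matrices. -/
def SlideEquiv {E : Type*} [DecidableEq E] : Matrix E E (ZMod 2) → Matrix E E (ZMod 2) → Prop :=
  Relation.ReflTransGen fun A A' => ∃ a b, a ≠ b ∧ A' = A.slide a b

variable [DecidableEq E]

theorem SlideConn.slideEquiv {A A' : Matrix E E (ZMod 2)} (h : SlideConn A A') : SlideEquiv A A' :=
  Relation.ReflTransGen.mono (fun _ _ hs => hs.2.2) _ _ h

omit [Fintype E] in
theorem SlideEquiv.symm {A A' : Matrix E E (ZMod 2)} (h : SlideEquiv A A') : SlideEquiv A' A := by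
  induction h with
  | refl => exact .refl
  | tail _ hs ih =>
    obtain ⟨a, b, hab, rfl⟩ := hs
    exact .head ⟨a, b, hab, (slide_slide _ hab).symm⟩ ih

omit [Fintype E] in
theorem SlideEquiv.isSymm {A A' : Matrix E E (ZMod 2)} (h : SlideEquiv A A') (hA : A.IsSymm) :
    A'.IsSymm := by
  induction h with
  | refl => exact hA
  | tail _ hs ih =>
    obtain ⟨a, b, -, rfl⟩ := hs
    exact ih.slide a b

omit [Fintype E] in
theorem SlideEquiv.diag_eq_zero {A A' : Matrix E E (ZMod 2)} (h : SlideEquiv A A') (hA : A.IsSymm)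
    (hd : ∀ e, A e e = 0) (e : E) : A' e e = 0 := by
  induction h generalizing e with
  | refl => exact hd e
  | tail h' hs ih =>
    obtain ⟨a, b, -, rfl⟩ := hs
    exact (SlideEquiv.isSymm h' hA).slide_diag_eq_zero ih a b e

theorem SlideEquiv.card_zero_rows {A A' : Matrix E E (ZMod 2)} (h : SlideEquiv A A')
    (hA : A.IsSymm) (hm : ∀ e, A.IsMatchingRow e) (hm' : ∀ e, A'.IsMatchingRow e) :
    Nat.card {e // ∀ f, A e f = 0} = Nat.card {e // ∀ f, A' e f = 0} := by
  have hker : Nat.card {x : E → ZMod 2 // A *ᵥ x = 0} =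
      Nat.card {x : E → ZMod 2 // A' *ᵥ x = 0} := by
    clear hm hm'
    induction h with
    | refl => rfl
    | tail _ hs ih =>
      obtain ⟨a, b, hab, rfl⟩ := hs
      rw [ih, card_ker_slide _ hab]
  rw [card_ker_of_isMatchingRow hA hm, card_ker_of_isMatchingRow (h.isSymm hA) hm'] at hker
  exact Nat.pow_right_injective le_rfl hker

/-- An interlacement matrix that is equivalent to a matched matrix is joined to it through
interlacement matrices. -/
theorem IsGraphic.slideConn {A C : Matrix E E (ZMod 2)} (hA : A.IsGraphic)
    (hC : ∀ e, C.IsMatchingRow e) (h : SlideEquiv A C) : SlideConn A C := by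
  have hCs := h.isSymm hA.1
  obtain ⟨B, hAB, hB, hmB⟩ := hA.exists_matching
  have hBC : SlideEquiv B C := hAB.slideEquiv.symm.trans h
  by_cases hd : ∀ e, B e e = 0
  · obtain ⟨σ, hσ⟩ := exists_perm_of_alternating hB hmB hd hCs hC (hBC.diag_eq_zero hB hd)
      (hBC.card_zero_rows hB hmB hC)
    have := slideConn_submatrix σ hB hmB
    rw [hσ] at this
    exact hAB.trans this
  -- A zero diagonal would be carried back from `C` to `B`. Hence both matrices can be diagonalised,
  -- and the path from `C` is reversed at the end.
  · have hd' : ∃ c, C c c ≠ 0 := by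
      by_contra! hn
      exact hd (hBC.symm.diag_eq_zero hCs hn)
    push Not at hd
    obtain ⟨B', hB', hdB'⟩ := exists_slideConn_diagonal hB hmB hd
    obtain ⟨C', hC', hdC'⟩ := exists_slideConn_diagonal hCs hC hd'
    have hB'C' : SlideEquiv B' C' :=
      hB'.slideEquiv.symm.trans (hBC.trans hC'.slideEquiv)
    have hrow : ∀ D : Matrix E E (ZMod 2), (∀ e f, e ≠ f → D e f = 0) → ∀ e, D.IsMatchingRow e := by
      intro D hD e f g hf hg
      have h1 : e = f := by by_contra hn; exact hf (hD e f hn)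
      have h2 : e = g := by by_contra hn; exact hg (hD e g hn)
      rw [← h1, ← h2]
    have hB's := hB'.slideEquiv.isSymm hB
    obtain ⟨σ, hσ⟩ := exists_perm_of_diagonal hdB' hdC'
      (hB'C'.card_zero_rows hB's (hrow _ hdB') (hrow _ hdC'))
    have := slideConn_submatrix σ hB's (hrow _ hdB')
    rw [hσ] at this
    exact hAB.trans (hB'.trans (this.trans hC'.symm))

end Matrix

/-! ### Boundary components and interlacement matrices -/

section EndSum

variable {E : Type*} [DecidableEq E]

/-- The sum of the labels of the ends up to and including `h` in a list of ends. -/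
def List.endSum (y : E → ZMod 2) : List (E × Bool) → E × Bool → ZMod 2
  | [], _ => 0
  | g :: L, h => y g.1 + if g = h then 0 else List.endSum y L h

namespace List

variable (y : E → ZMod 2) {L M : List (E × Bool)} {h : E × Bool}

theorem endSum_append_of_mem (hL : h ∈ L) : (L ++ M).endSum y h = L.endSum y h := by
  induction L with
  | nil => simp at hL
  | cons g L ih =>
    simp only [cons_append, endSum]
    split_ifs with hg
    · rfl
    · rw [ih ((mem_cons.mp hL).resolve_left (Ne.symm hg))]

theorem endSum_append_of_notMem (hL : h ∉ L) :
    (L ++ M).endSum y h = (L.map fun g => y g.1).sum + M.endSum y h := by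
  induction L with
  | nil => simp
  | cons g L ih =>
    rw [mem_cons, not_or] at hL
    simp only [cons_append, endSum, if_neg (Ne.symm hL.1), ih hL.2, map_cons, sum_cons]
    ring

theorem endSum_getElem (hL : L.Nodup) (i : ℕ) (hi : i < L.length) :
    L.endSum y L[i] = ((L.take (i + 1)).map fun g => y g.1).sum := by
  induction L generalizing i with
  | nil => simp at hi
  | cons g L ih =>
    rw [nodup_cons] at hL
    rcases i with _ | i
    · simp [endSum]
    · have hi' : i < L.length := by simpa using hi
      have hne : g ≠ L[i] := fun h => hL.1 (h ▸ getElem_mem hi')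
      simp [endSum, hne, ih hL.2 i hi']

/-- The vanishing of the total is needed only for the step from the last end back to the first. -/
theorem endSum_formPerm (hL : L.Nodup) (h0 : (L.map fun g => y g.1).sum = 0) (hm : h ∈ L) :
    L.endSum y (L.formPerm h) = L.endSum y h + y (L.formPerm h).1 := by
  obtain ⟨i, hi, rfl⟩ := getElem_of_mem hm
  rw [formPerm_apply_getElem L hL i hi]
  by_cases h1 : i + 1 < L.length
  · simp only [Nat.mod_eq_of_lt h1]
    rw [endSum_getElem y hL, endSum_getElem y hL, take_succ_eq_append_getElem h1, map_append,
      sum_append]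
    simp
  · have h2 : i + 1 = L.length := by omega
    simp only [h2, Nat.mod_self]
    rw [endSum_getElem y hL, endSum_getElem y hL, (by rw [h2, take_length] : L.take (i + 1) = L),
      h0]
    cases L with
    | nil => simp at hi
    | cons g L => simp

theorem orderedPairs_self (L : List E) (e : E) : L.orderedPairs e e = (L.count e).choose 2 := by
  induction L with
  | nil => simp [orderedPairs]
  | cons g L ih =>
    rw [orderedPairs, ih, count_cons]
    by_cases hg : g = e
    · subst hg
      simp [Nat.choose_succ_succ' _ 1]
    · simp [hg]

theorem count_map_fst (L : List (E × Bool)) (e : E) :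
    (L.map Prod.fst).count e = L.count (e, false) + L.count (e, true) := by
  induction L with
  | nil => rfl
  | cons g L ih =>
    obtain ⟨g, b⟩ := g
    simp only [map_cons, count_cons, ih, beq_iff_eq, Prod.mk.injEq]
    cases b <;> by_cases hg : g = e <;> simp [hg] <;> ring

/-- The counts serve as weights so that the induction can pass through lists lacking an end of `e`.
When both ends are present, the left side is the sum of the two partial sums, and the right side is
almost row `e` of the interlacement matrix applied to `y`. -/
theorem sum_count_mul_endSum [Fintype E] (hL : L.Nodup) (e : E) :
    L.count (e, false) * L.endSum y (e, false) + L.count (e, true) * L.endSum y (e, true) =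
      ∑ f, (L.map Prod.fst).orderedPairs f e * y f + (L.map Prod.fst).count e * y e := by
  induction L with
  | nil => simp [orderedPairs]
  | cons g L ih =>
    rw [nodup_cons] at hL
    have key : ∀ b, ((g :: L).count (e, b) : ZMod 2) * (g :: L).endSum y (e, b) =
        L.count (e, b) * y g.1 + L.count (e, b) * L.endSum y (e, b) +
          if g = (e, b) then y e else 0 := by
      intro b
      by_cases hg : g = (e, b)
      · subst hg
        simp [endSum, count_eq_zero.mpr hL.1]
      · simp [endSum, hg, mul_add]
    have hsum : ∑ f, (List.map Prod.fst (g :: L)).orderedPairs f e * y f =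
        (L.map Prod.fst).count e * y g.1 + ∑ f, (L.map Prod.fst).orderedPairs f e * y f := by
      simp only [map_cons, orderedPairs, add_mul, Finset.sum_add_distrib, ite_mul, zero_mul,
        Finset.sum_ite_eq, Finset.mem_univ, if_true]
    have hc : ((List.map Prod.fst (g :: L)).count e : ZMod 2) * y e =
        (L.map Prod.fst).count e * y e + ((if g = (e, false) then y e else 0) +
          if g = (e, true) then y e else 0) := by
      obtain ⟨g, b⟩ := g
      simp only [map_cons, count_cons, beq_iff_eq, Prod.mk.injEq]
      cases b <;> by_cases hg : g = e <;> simp [hg] <;> ring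
    rw [key, key, hsum, hc, count_map_fst, Nat.cast_add, ← sub_eq_zero]
    rw [count_map_fst, Nat.cast_add] at ih
    linear_combination ih hL.2

end List

end EndSum

namespace RibbonGraph

variable {V E : Type*} (G : RibbonGraph V E)

theorem connected_iff_eq (hloop : ∀ e, G.vert (e, false) = G.vert (e, true)) {v w : V} :
    G.Connected v w ↔ v = w := by
  constructor
  · intro h
    induction h with
    | rel _ _ h => obtain ⟨e, rfl, rfl⟩ := h; exact hloop e
    | refl => rfl
    | symm _ _ _ ih => exact ih.symm
    | trans _ _ _ _ _ ih1 ih2 => exact ih1.trans ih2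
  · rintro rfl; exact .refl _

theorem vert_rot (h : E × Bool) : G.vert (G.rot h) = G.vert h :=
  ((G.sameCycle_iff _ _).mp (Equiv.Perm.sameCycle_apply_left.mpr (.refl _ _)))

theorem exists_point (v : V) : ∃ p : G.BoundaryPoint, G.pointVert p = v := by
  by_cases h : ∃ h, G.vert h = v
  · obtain ⟨h, rfl⟩ := h; exact ⟨Sum.inl (h, false), rfl⟩
  · push Not at h
    exact ⟨Sum.inr ⟨v, h⟩, rfl⟩

/-- If the edgeless spanning subgraph is a spanning quasi-tree, then all edges are loops. -/
theorem vert_eq_of_isSpanningQuasiTree_empty (h : G.IsSpanningQuasiTree ∅) (e : E) :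
    G.vert (e, false) = G.vert (e, true) := by
  obtain ⟨c, -, hc⟩ := h (G.vert (e, false))
  -- Without edges, no boundary arc leaves its vertex, so a boundary component has a well-defined
  -- vertex.
  let φ : G.BoundaryComponent ∅ → V := Quot.lift G.pointVert (by
    intro p q hpq
    cases hpq with
    | vertexArc h => exact (G.vert_rot h).symm
    | segment h hA => rfl
    | side e s hA => exact absurd hA (Set.notMem_empty e)
    | twistedSide e s hA => exact absurd hA (Set.notMem_empty e))
  have h1 := hc (Quot.mk _ (Sum.inl ((e, false), false))) ⟨_, rfl, .refl _⟩
  have h2 := hc (Quot.mk _ (Sum.inl ((e, true), false))) ⟨_, rfl, .rel _ _ ⟨e, rfl, rfl⟩⟩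
  exact congrArg φ (h1.trans h2.symm)

variable [DecidableEq E]

/-- The ends, listed vertex by vertex in the cyclic order of the vertices. -/
structure IsEndList (L : List (E × Bool)) : Prop where
  nodup : L.Nodup
  mem : ∀ h, h ∈ L
  endSum_rot : ∀ (y : E → ZMod 2) (h : E × Bool),
    L.endSum y (G.rot h) = L.endSum y h + y (G.rot h).1

/-- Functions on the marked points that are constant on boundary components are compared with kernel
vectors of the submatrix on `X`: `y e` is the jump across the segment of an end of `e`, and `endSum`
recovers the function up to a constant at each vertex. Since all edges are loops, components are
single vertices, and uniqueness of the boundary component means that all jumps vanish. -/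
theorem isSpanningQuasiTree_iff [Fintype E] (hloop : ∀ e, G.vert (e, false) = G.vert (e, true))
    {L : List (E × Bool)} (hL : G.IsEndList L) {A : Matrix E E (ZMod 2)} (hA : A.IsSymm)
    (hw : A.IsWord Finset.univ (L.map Prod.fst))
    (hd1 : ∀ e ∈ G.twisted, A e e = 1) (hd0 : ∀ e ∉ G.twisted, A e e = 0) (X : Set E) :
    G.IsSpanningQuasiTree X ↔ X ∈ (SetSystem.ofMatrix A).feasible := by
  have hsum : ∀ (y : E → ZMod 2) (e : E), (e ∈ G.twisted →
      (A *ᵥ y) e = L.endSum y (e, false) + L.endSum y (e, true)) ∧ (e ∉ G.twisted →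
      (A *ᵥ y) e = L.endSum y (e, false) + L.endSum y (e, true) + y e) := by
    intro y e
    have h1 := List.sum_count_mul_endSum y hL.nodup e
    have h2 : (L.map Prod.fst).count e = 2 := by rw [hw.1]; simp
    rw [List.count_eq_one_of_mem hL.nodup (hL.mem _), List.count_eq_one_of_mem hL.nodup (hL.mem _),
      h2] at h1
    have h3 : ∑ f, (L.map Prod.fst).orderedPairs f e * y f = (A *ᵥ y) e + (A e e + 1) * y e := by
      rw [Matrix.mulVec, dotProduct, ← Finset.add_sum_erase _ _ (Finset.mem_univ e),
        ← Finset.add_sum_erase _ (fun f => A e f * y f) (Finset.mem_univ e),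
        List.orderedPairs_self, h2]
      have : ∑ f ∈ Finset.univ.erase e, (L.map Prod.fst).orderedPairs f e * y f =
          ∑ f ∈ Finset.univ.erase e, A e f * y f := by
        refine Finset.sum_congr rfl fun f hf => ?_
        rw [← hw.2 f (Finset.mem_univ f) e (Finset.mem_univ e) (Finset.ne_of_mem_erase hf),
          hA.apply]
      rw [this]
      simp only [Nat.choose_self, Nat.cast_one]
      linear_combination -(A e e * y e) * (CharTwo.two_eq_zero : (2 : ZMod 2) = 0)
    rw [h3] at h1
    simp only [Nat.cast_one, one_mul, Nat.cast_ofNat, (show (2 : ZMod 2) = 0 from rfl), zero_mul,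
      add_zero] at h1
    constructor
    · intro he
      rw [h1, hd1 e he, (show (1 : ZMod 2) + 1 = 0 from rfl), zero_mul, add_zero]
    · intro he
      rw [h1, hd0 e he, zero_add, one_mul, add_assoc, CharTwo.add_self_eq_zero, add_zero]
  have hinv : ∀ (y : E → ZMod 2) (h : E × Bool),
      L.endSum y h = L.endSum y (G.rot.symm h) + y h.1 := by
    intro y h
    have := hL.endSum_rot y (G.rot.symm h)
    rwa [Equiv.apply_symm_apply] at this
  constructor
  · intro hX y hy hAy
    -- Constancy along vertex arcs is built in, along segments it is `y = 0` off `X`, and along the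
    -- sides of `e ∈ X` it is `(A *ᵥ y) e = 0`.
    let g : G.BoundaryPoint → ZMod 2 := fun p => match p with
      | Sum.inl (h, true) => L.endSum y h
      | Sum.inl (h, false) => L.endSum y (G.rot.symm h)
      | Sum.inr _ => 0
    have hg : ∀ p q, G.BoundaryArc X p q → g p = g q := by
      intro p q hpq
      cases hpq with
      | vertexArc h => simp [g]
      | segment h hh =>
        have := hinv y h
        rw [hy _ hh, add_zero] at this
        exact this.symm
      | side e s he ht =>
        have h1 := (hsum y e).2 ht
        rw [hAy e he] at h1
        have h2 := hinv y (e, false)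
        have h3 := hinv y (e, true)
        cases s
        · simp only [g, Bool.not_false]
          grind
        · simp only [g, Bool.not_true]
          grind
      | twistedSide e s he ht =>
        have h1 := (hsum y e).1 ht
        rw [hAy e he] at h1
        have h2 := hinv y (e, false)
        have h3 := hinv y (e, true)
        cases s
        · simp only [g]
          grind
        · simp only [g]
          grind
    funext e
    obtain ⟨c, -, hc⟩ := hX (G.vert (e, false))
    have h1 := hc (Quot.mk _ (Sum.inl ((e, false), false))) ⟨_, rfl, .refl _⟩
    have h2 := hc (Quot.mk _ (Sum.inl ((e, false), true))) ⟨_, rfl, .refl _⟩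
    have h3 : L.endSum y (G.rot.symm (e, false)) = L.endSum y (e, false) :=
      congrArg (Quot.lift g hg) (h1.trans h2.symm)
    have h4 := hinv y (e, false)
    rw [h3] at h4
    exact left_eq_add.mp h4
  · intro hX v
    obtain ⟨p, hp⟩ := G.exists_point v
    refine ⟨Quot.mk _ p, ⟨p, rfl, (G.connected_iff_eq hloop).mpr hp.symm⟩, ?_⟩
    rintro _ ⟨q, rfl, hq⟩
    rw [G.connected_iff_eq hloop, ← hp] at hq
    by_contra hne
    classical
    -- The indicator of one of two boundary components at the same vertex; its jumps form a kernel
    -- vector, so they vanish and the indicator is constant there.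
    let g : G.BoundaryPoint → ZMod 2 := fun r =>
      if (Quot.mk _ r : G.BoundaryComponent X) = Quot.mk _ p then 1 else 0
    have hg : ∀ {r r'}, G.BoundaryArc X r r' → g r = g r' := by
      intro r r' hr
      have : (Quot.mk _ r : G.BoundaryComponent X) = Quot.mk _ r' := Quot.sound hr
      simp only [g, this]
    have hgf : ∀ h, g (Sum.inl (h, false)) = g (Sum.inl (G.rot.symm h, true)) := by
      intro h
      have := hg (.vertexArc (A := X) (G.rot.symm h))
      rw [Equiv.apply_symm_apply] at this
      exact this.symm
    let x : E × Bool → ZMod 2 := fun h => g (Sum.inl (h, true))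
    let y : E → ZMod 2 := fun e => x (e, false) + x (G.rot.symm (e, false))
    have hside : ∀ e ∈ X, (e ∈ G.twisted → x (e, false) = x (e, true) ∧
        x (G.rot.symm (e, false)) = x (G.rot.symm (e, true))) ∧ (e ∉ G.twisted →
        x (e, false) = x (G.rot.symm (e, true)) ∧ x (G.rot.symm (e, false)) = x (e, true)) := by
      intro e he
      refine ⟨fun ht => ⟨hg (.twistedSide e true he ht), ?_⟩, fun ht => ⟨?_, ?_⟩⟩
      · exact (hgf _).symm.trans ((hg (.twistedSide e false he ht)).trans (hgf _))
      · exact (hg (.side e true he ht)).trans (hgf _)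
      · exact (hgf _).symm.trans (hg (.side e false he ht))
    have hseg : ∀ h : E × Bool, h.1 ∉ X → x (G.rot.symm h) = x h := fun h hh =>
      (hgf h).symm.trans (hg (.segment h hh))
    have hxy : ∀ h : E × Bool, x h = x (G.rot.symm h) + y h.1 := by
      rintro ⟨e, b⟩
      by_cases he : e ∈ X
      · by_cases ht : e ∈ G.twisted
        · obtain ⟨h1, h2⟩ := (hside e he).1 ht
          have h3 : ∀ a : ZMod 2, a + a = 0 := CharTwo.add_self_eq_zero
          cases b <;> simp only [y] <;> grind
        · obtain ⟨h1, h2⟩ := (hside e he).2 ht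
          have h3 : ∀ a : ZMod 2, a + a = 0 := CharTwo.add_self_eq_zero
          cases b <;> simp only [y] <;> grind
      · have : y e = 0 := by
          simp only [y]
          rw [hseg (e, false) he, CharTwo.add_self_eq_zero]
        rw [this, add_zero, hseg (e, b) he]
    have hz : ∀ h, x (G.rot h) + L.endSum y (G.rot h) = x h + L.endSum y h := by
      intro h
      have h1 := hxy (G.rot h)
      rw [Equiv.symm_apply_apply] at h1
      rw [h1, hL.endSum_rot y h]
      linear_combination y (G.rot h).1 * (CharTwo.two_eq_zero : (2 : ZMod 2) = 0)
    have hconst : ∀ f : E × Bool → ZMod 2, (∀ h, f (G.rot h) = f h) → ∀ h h',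
        G.vert h = G.vert h' → f h = f h' := by
      intro f hf h h' hh
      obtain ⟨i, rfl⟩ := ((G.sameCycle_iff h h').mpr hh).exists_nat_pow_eq
      clear hh
      induction i with
      | zero => rfl
      | succ i ih => rw [pow_succ', Equiv.Perm.mul_apply, hf, ← ih]
    have hy0 : y = 0 := by
      refine hX y (fun e he => ?_) (fun e he => ?_)
      · simp only [y]
        rw [hseg (e, false) he, CharTwo.add_self_eq_zero]
      · have h1 := hconst (fun h => x h + L.endSum y h) hz (e, false) (e, true) (hloop e)
        have h2 := hxy (e, true)
        by_cases ht : e ∈ G.twisted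
        · rw [(hsum y e).1 ht]
          have h3 := ((hside e he).1 ht).1
          grind
        · rw [(hsum y e).2 ht]
          have h3 := ((hside e he).2 ht).1
          grind
    have hx : ∀ h, x (G.rot h) = x h := by
      intro h
      have := hxy (G.rot h)
      rwa [hy0, Equiv.symm_apply_apply, Pi.zero_apply, add_zero] at this
    have hgx : ∀ h b, g (Sum.inl (h, b)) = x h := by
      intro h b
      cases b
      · rw [hgf]
        have := hx (G.rot.symm h)
        rw [Equiv.apply_symm_apply] at this
        exact this.symm
      · rfl
    have hgp : g p = 1 := if_pos rfl
    have hgq : g q = 0 := if_neg hne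
    rcases p with ⟨h, b⟩ | ⟨w, hw'⟩ <;> rcases q with ⟨h', b'⟩ | ⟨w', hw''⟩
    · rw [hgx] at hgp hgq
      rw [hconst x hx h h' hq, hgq] at hgp
      exact absurd hgp (by decide)
    · exact hw'' h hq
    · exact hw' h' hq.symm
    · have : w = w' := hq
      subst this
      exact hne rfl

end RibbonGraph

/-! ### From ribbon graphs to words -/

namespace RibbonGraph

variable {V E : Type*} [DecidableEq E] (G : RibbonGraph V E)

theorem sum_map_eq_zero (hloop : ∀ e, G.vert (e, false) = G.vert (e, true)) {v : V}
    {l : List (E × Bool)} (hl : l.Nodup) (hm : ∀ h, h ∈ l ↔ G.vert h = v) (y : E → ZMod 2) :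
    (l.map fun g => y g.1).sum = 0 := by
  rw [← List.sum_toFinset _ hl]
  refine Finset.sum_involution (fun g _ => (g.1, !g.2)) ?_ ?_ ?_ ?_
  · intro g _
    exact CharTwo.add_self_eq_zero _
  · rintro ⟨e, b⟩ _ _ h
    simp at h
  · rintro ⟨e, b⟩ hg
    rw [List.mem_toFinset, hm] at hg ⊢
    rw [← hg]
    cases b
    · exact (hloop e).symm
    · exact hloop e
  · rintro ⟨e, b⟩ _
    simp

theorem exists_vertex_list [Fintype E] (hloop : ∀ e, G.vert (e, false) = G.vert (e, true))
    (v : V) : ∃ l : List (E × Bool), l.Nodup ∧ (∀ h, h ∈ l ↔ G.vert h = v) ∧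
      ∀ (y : E → ZMod 2), ∀ h ∈ l, l.endSum y (G.rot h) = l.endSum y h + y (G.rot h).1 := by
  by_cases hv : ∃ h, G.vert h = v
  · obtain ⟨⟨e, b⟩, rfl⟩ := hv
    have hsupp : (e, b) ∈ G.rot.support := by
      rw [Equiv.Perm.mem_support]
      intro hfix
      have hs : G.rot.SameCycle (e, b) (e, !b) := by
        rw [G.sameCycle_iff]
        cases b
        · exact hloop e
        · exact (hloop e).symm
      have := hs.eq_of_left hfix
      simp at this
    have hm : ∀ h, h ∈ G.rot.toList (e, b) ↔ G.vert h = G.vert (e, b) := by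
      intro h
      rw [Equiv.Perm.mem_toList_iff, G.sameCycle_iff, eq_comm]
      exact and_iff_left hsupp
    refine ⟨G.rot.toList (e, b), Equiv.Perm.nodup_toList _ _, hm, fun y h hh => ?_⟩
    have h1 := List.endSum_formPerm y (Equiv.Perm.nodup_toList G.rot (e, b))
      (G.sum_map_eq_zero hloop (Equiv.Perm.nodup_toList _ _) hm y) hh
    rw [Equiv.Perm.formPerm_toList,
      Equiv.Perm.SameCycle.cycleOf_apply ((Equiv.Perm.mem_toList_iff.mp hh).1)] at h1
    exact h1
  · push Not at hv
    exact ⟨[], List.nodup_nil, fun h => by simpa using hv h, fun _ _ h => by simp at h⟩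

/-- Vertex lists are concatenated. Earlier vertices only add a constant to `endSum`, and the
recurrence along `rot` stays within one vertex. -/
theorem exists_isEndList [Finite V] [Fintype E]
    (hloop : ∀ e, G.vert (e, false) = G.vert (e, true)) : ∃ L, G.IsEndList L := by
  classical
  have := Fintype.ofFinite V
  have key : ∀ S : Finset V, ∃ L : List (E × Bool), L.Nodup ∧ (∀ h, h ∈ L ↔ G.vert h ∈ S) ∧
      ∀ (y : E → ZMod 2), ∀ h ∈ L, L.endSum y (G.rot h) = L.endSum y h + y (G.rot h).1 := by
    intro S
    induction S using Finset.induction_on with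
    | empty => exact ⟨[], List.nodup_nil, by simp, by simp⟩
    | insert v S hv ih =>
      obtain ⟨L, hL, hLm, hLy⟩ := ih
      obtain ⟨l, hl, hlm, hly⟩ := G.exists_vertex_list hloop v
      have hdisj : ∀ h ∈ l, h ∉ L := by
        intro h hh hh'
        rw [hlm] at hh
        rw [hLm, hh] at hh'
        exact hv hh'
      refine ⟨l ++ L, List.nodup_append'.mpr ⟨hl, hL, hdisj⟩, fun h => ?_, fun y h hh => ?_⟩
      · rw [List.mem_append, hlm, hLm, Finset.mem_insert]
      · by_cases hhl : h ∈ l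
        · have : G.rot h ∈ l := by rw [hlm, G.vert_rot, ← hlm]; exact hhl
          rw [List.endSum_append_of_mem y hhl, List.endSum_append_of_mem y this, hly y h hhl]
        · have : G.rot h ∉ l := by rw [hlm, G.vert_rot, ← hlm]; exact hhl
          rw [List.endSum_append_of_notMem y hhl, List.endSum_append_of_notMem y this,
            hLy y h ((List.mem_append.mp hh).resolve_left hhl), add_assoc]
  obtain ⟨L, hL, hm, hy⟩ := key Finset.univ
  have hm' : ∀ h, h ∈ L := fun h => (hm h).mpr (Finset.mem_univ _)
  exact ⟨L, hL, hm', fun y h => hy y h (hm' h)⟩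

/-- The delta-matroid of a ribbon graph is binary and given by an interlacement matrix, if the
empty set is feasible. -/
theorem exists_isGraphic [Finite V] [Fintype E] (h : ∅ ∈ G.deltaMatroid.feasible) :
    ∃ A : Matrix E E (ZMod 2), A.IsGraphic ∧ SetSystem.ofMatrix A = G.deltaMatroid := by
  classical
  have hloop := G.vert_eq_of_isSpanningQuasiTree_empty h
  obtain ⟨L, hL⟩ := G.exists_isEndList hloop
  let A : Matrix E E (ZMod 2) := Matrix.of fun e f =>
    if e = f then (if e ∈ G.twisted then 1 else 0) else (L.map Prod.fst).orderedPairs e f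
  have hc : ∀ e, (L.map Prod.fst).count e = 2 := by
    intro e
    rw [List.count_map_fst, List.count_eq_one_of_mem hL.nodup (hL.mem _),
      List.count_eq_one_of_mem hL.nodup (hL.mem _)]
  have hw : A.IsWord Finset.univ (L.map Prod.fst) := by
    refine ⟨fun e => by rw [hc, if_pos (Finset.mem_univ e)], fun e _ f _ hef => ?_⟩
    simp only [A, Matrix.of_apply, if_neg hef]
  have hA : A.IsSymm := by
    ext e f
    rw [Matrix.transpose_apply]
    rcases eq_or_ne e f with rfl | hef
    · rfl
    · rw [hw.2 e (Finset.mem_univ e) f (Finset.mem_univ f) hef,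
        hw.2 f (Finset.mem_univ f) e (Finset.mem_univ e) hef.symm, ← CharTwo.add_eq_zero,
        List.orderedPairs_add_swap _ hef.symm, hc, hc]
      rfl
  refine ⟨A, ⟨hA, _, hw⟩, ?_⟩
  ext X
  exact (G.isSpanningQuasiTree_iff hloop hL hA hw
    (fun e he => by simp only [A, Matrix.of_apply, if_true, if_pos he])
    (fun e he => by simp only [A, Matrix.of_apply, if_true, if_neg he]) X).symm

end RibbonGraph

/-! ### From words to ribbon graphs -/

section TagEnds

variable {E : Type*} [DecidableEq E]

/-- Turns a double occurrence word into a list of ends. -/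
def List.tagEnds : List E → List (E × Bool)
  | [] => []
  | g :: L => (g, decide (g ∈ L)) :: L.tagEnds

namespace List

theorem map_fst_tagEnds (L : List E) : L.tagEnds.map Prod.fst = L := by
  induction L with
  | nil => rfl
  | cons g L ih => rw [tagEnds, map_cons, ih]

theorem mem_of_mem_tagEnds {L : List E} {e : E} {b : Bool} (h : (e, b) ∈ L.tagEnds) : e ∈ L := by
  rw [← map_fst_tagEnds L]
  exact mem_map_of_mem h

theorem two_le_count_of_mem_tagEnds {L : List E} {e : E} (h : (e, true) ∈ L.tagEnds) :
    2 ≤ L.count e := by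
  induction L with
  | nil => simp [tagEnds] at h
  | cons g L ih =>
    rw [tagEnds, mem_cons, Prod.mk.injEq] at h
    rcases h with ⟨rfl, h⟩ | h
    · have : e ∈ L := by simpa using h
      rw [count_cons_self]
      have := count_pos_iff.mpr this
      omega
    · exact (ih h).trans (count_le_count_cons)

/-- The tag says whether the letter occurs again later, so two occurrences of a letter receive
different tags. -/
theorem nodup_tagEnds {L : List E} (hL : ∀ e, L.count e ≤ 2) : L.tagEnds.Nodup := by
  induction L with
  | nil => exact nodup_nil
  | cons g L ih =>
    rw [tagEnds, nodup_cons]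
    refine ⟨fun h => ?_, ih fun e => (count_le_count_cons).trans (hL e)⟩
    by_cases hg : g ∈ L
    · rw [decide_eq_true hg] at h
      have h1 := two_le_count_of_mem_tagEnds h
      have h2 := hL g
      rw [count_cons_self] at h2
      omega
    · exact hg (mem_of_mem_tagEnds h)

end List

end TagEnds

namespace Matrix

variable {E : Type*} [DecidableEq E] [Fintype E]

/-- The word is wrapped around a single vertex, and the diagonal prescribes the half twists. -/
theorem IsGraphic.exists_ribbonGraph {A : Matrix E E (ZMod 2)} (hA : A.IsGraphic) :
    ∃ G : RibbonGraph Unit E, SetSystem.ofMatrix A = G.deltaMatroid := by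
  obtain ⟨hs, W, hW⟩ := hA
  have hc : ∀ e, W.count e = 2 := fun e => by rw [hW.1, if_pos (Finset.mem_univ e)]
  have hnd : W.tagEnds.Nodup := List.nodup_tagEnds fun e => (hc e).le
  have hmem : ∀ h, h ∈ W.tagEnds := by
    rintro ⟨e, b⟩
    have h1 := List.count_map_fst W.tagEnds e
    rw [List.map_fst_tagEnds, hc] at h1
    have h2 := List.nodup_iff_count_le_one.mp hnd
    have h3 := h2 (e, false)
    have h4 := h2 (e, true)
    rw [← List.count_pos_iff]
    cases b <;> omega
  have hcycle : ∀ h h', W.tagEnds.formPerm.SameCycle h h' := by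
    intro h h'
    have hlen : 2 ≤ W.tagEnds.length := by
      have := (hc h.1).symm.le.trans (List.count_le_length)
      rwa [← List.length_map (f := Prod.fst), List.map_fst_tagEnds]
    have hsupp : ∀ k, W.tagEnds.formPerm k ≠ k := by
      intro k
      rw [← Equiv.Perm.mem_support, List.support_formPerm_of_nodup _ hnd]
      · exact List.mem_toFinset.mpr (hmem k)
      · intro x hx
        rw [hx] at hlen
        simp at hlen
    exact (List.isCycle_formPerm hnd hlen).sameCycle (hsupp h) (hsupp h')
  let G : RibbonGraph Unit E :=
    { vert := fun _ => ()
      rot := W.tagEnds.formPerm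
      sameCycle_iff := fun h h' => iff_of_true (hcycle h h') rfl
      twisted := {e | A e e = 1} }
  refine ⟨G, ?_⟩
  have hL : G.IsEndList W.tagEnds :=
    { nodup := hnd
      mem := hmem
      endSum_rot := fun y h => List.endSum_formPerm y hnd
        (G.sum_map_eq_zero (v := ()) (fun _ => rfl) hnd
          (fun h => iff_of_true (hmem h) rfl) y) (hmem h) }
  ext X
  refine (G.isSpanningQuasiTree_iff (fun _ => rfl) hL hs (by rwa [List.map_fst_tagEnds])
    (fun e he => he) (fun e he => ?_) X).symm
  exact ((by decide : ∀ p : ZMod 2, p = 0 ∨ p = 1) (A e e)).resolve_right he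

end Matrix

theorem List.orderedPairs_map {E E' : Type*} [DecidableEq E] [DecidableEq E'] {g : E → E'}
    (hg : Function.Injective g) (L : List E) (e f : E) :
    (L.map g).orderedPairs (g e) (g f) = L.orderedPairs e f := by
  induction L with
  | nil => rfl
  | cons k L ih => simp only [map_cons, orderedPairs, ih, hg.eq_iff, count_map_of_injective L g hg]

theorem Matrix.IsGraphic.submatrix {E E' : Type*} [DecidableEq E] [DecidableEq E'] [Fintype E]
    [Fintype E'] {A : Matrix E' E' (ZMod 2)} (hA : A.IsGraphic) (g : E ≃ E') :
    (A.submatrix g g).IsGraphic := by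
  obtain ⟨hs, L, hL⟩ := hA
  have hg : (L.map g.symm).map g = L := by simp
  refine ⟨hs.submatrix g, L.map g.symm, fun e => ?_, fun e _ f _ hef => ?_⟩
  · rw [← List.count_map_of_injective _ g g.injective, hg, hL.1]
    simp
  · rw [← List.orderedPairs_map g.injective, hg, submatrix_apply]
    exact hL.2 _ (Finset.mem_univ _) _ (Finset.mem_univ _) (g.injective.ne hef)

/-! ### Transport along bijections and the canonical forms -/

namespace SetSystem

theorem mem_ofMatrix_submatrix {E E' : Type*} [Fintype E] [Fintype E'] (A : Matrix E' E' (ZMod 2))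
    (g : E ≃ E') (X : Set E) :
    X ∈ (ofMatrix (A.submatrix g g)).feasible ↔ g '' X ∈ (ofMatrix A).feasible := by
  have hmul : ∀ (y : E' → ZMod 2) e, (A.submatrix g g *ᵥ (y ∘ g)) e = (A *ᵥ y) (g e) := by
    intro y e
    rw [Matrix.submatrix_mulVec_equiv]
    simp [Function.comp_assoc]
  rw [mem_ofMatrix, mem_ofMatrix]
  constructor
  · intro h y hy hAy
    have := h (y ∘ g) (fun e he => hy _ (by simpa using he))
      (fun e he => by rw [hmul]; exact hAy _ (Set.mem_image_of_mem g he))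
    funext e
    have h1 := congrFun this (g.symm e)
    simpa using h1
  · intro h y hy hAy
    have hyg : (y ∘ g.symm) ∘ g = y := by funext e; simp
    have := h (y ∘ g.symm) (fun e he => hy _ (fun hn => he ⟨_, hn, by simp⟩)) (by
      rintro _ ⟨e, he, rfl⟩
      rw [← hmul, hyg]; exact hAy e he)
    rw [← hyg, this]; rfl

theorem exists_isGraphic {E : Type*} [Fintype E] [DecidableEq E] {D : SetSystem E}
    (hD : D.IsRibbonGraphic) (hempty : ∅ ∈ D.feasible) :
    ∃ A : Matrix E E (ZMod 2), A.IsGraphic ∧ ofMatrix A = D := by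
  classical
  obtain ⟨-, V, E', hV, hE', G, g, hg⟩ := hD
  have := Fintype.ofFinite E'
  obtain ⟨A, hA, hAG⟩ := G.exists_isGraphic (by rw [← Set.image_empty g, ← hg]; exact hempty)
  refine ⟨A.submatrix g g, hA.submatrix g, ?_⟩
  ext X
  rw [mem_ofMatrix_submatrix, hAG, hg]

theorem isRibbonGraphic_ofMatrix {E : Type*} [Fintype E] [DecidableEq E]
    {A : Matrix E E (ZMod 2)} (hA : A.IsGraphic) : (ofMatrix A).IsRibbonGraphic := by
  -- The ribbon graph must have its edges in `Type`, whereas `E` may live in any universe; hence the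
  -- passage to `Fin`.
  refine ⟨isDeltaMatroid_ofMatrix hA.1, Unit, Fin (Fintype.card E), inferInstance, inferInstance, ?_⟩
  let g := Fintype.equivFin E
  obtain ⟨G, hG⟩ := (hA.submatrix g.symm).exists_ribbonGraph
  refine ⟨G, g, fun X => ?_⟩
  rw [← hG, mem_ofMatrix_submatrix]
  simp

/-- The feasible sets given by the matrix of a matching in which loops are allowed. -/
theorem mem_ofMatrix_iff_of_isMatchingRow {E : Type*} [Fintype E] {A : Matrix E E (ZMod 2)}
    (hA : A.IsSymm) (hm : ∀ e, A.IsMatchingRow e) (X : Set E) :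
    X ∈ (ofMatrix A).feasible ↔ ∀ e ∈ X, ∃ f ∈ X, A e f ≠ 0 := by
  classical
  rw [mem_ofMatrix]
  constructor
  · intro h e he
    by_contra! hcon
    have h0 := h (Pi.single e 1) (fun f hf => Pi.single_eq_of_ne (by rintro rfl; exact hf he) _)
      (fun f hf => by
        rw [Matrix.mulVec_single]
        have := hcon f hf
        rw [← hA.apply] at this
        simpa using this)
    simpa using congrFun h0 e
  · intro h y hy hAy
    funext e
    by_cases he : e ∈ X
    · obtain ⟨f, hf, hef⟩ := h e he
      have hfe : A f e ≠ 0 := by rwa [hA.apply]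
      rw [← Matrix.mulVec_apply_of_isMatchingRow (hm f) hfe y, hAy f hf, Pi.zero_apply]
    · exact hy e he

/-- The partner of an element in the canonical form. -/
def canonicalPartner {i j k : ℕ} :
    (Fin i × Unit) ⊕ ((Fin j × Bool) ⊕ (Fin k × Unit)) →
      Option ((Fin i × Unit) ⊕ ((Fin j × Bool) ⊕ (Fin k × Unit)))
  | .inl _ => none
  | .inr (.inl (t, b)) => some (.inr (.inl (t, !b)))
  | .inr (.inr t) => some (.inr (.inr t))

/-- This brings the direct sum into the form of `mem_ofMatrix_iff_of_isMatchingRow`, with partners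
in place of nonzero entries. -/
theorem mem_canonical_iff {i j k : ℕ} (X : Set ((Fin i × Unit) ⊕ ((Fin j × Bool) ⊕ (Fin k × Unit)))) :
    X ∈ (canonical i j k).feasible ↔ ∀ s ∈ X, ∃ t ∈ X, canonicalPartner s = some t := by
  have h : X ∈ (canonical i j k).feasible ↔ (∀ t : Fin i, {e | Sum.inl (t, e) ∈ X} = (∅ : Set Unit)) ∧
      (∀ t : Fin j, {e | Sum.inr (Sum.inl (t, e)) ∈ X} = (∅ : Set Bool) ∨
        {e | Sum.inr (Sum.inl (t, e)) ∈ X} = (Set.univ : Set Bool)) ∧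
      (∀ t : Fin k, {e | Sum.inr (Sum.inr (t, e)) ∈ X} = (∅ : Set Unit) ∨
        {e | Sum.inr (Sum.inr (t, e)) ∈ X} = (Set.univ : Set Unit)) := Iff.rfl
  rw [h]
  constructor
  · rintro ⟨h1, h2, h3⟩ (⟨t, u⟩ | ⟨t, b⟩ | ⟨t, u⟩) hs
    · have : u ∈ {e | Sum.inl (t, e) ∈ X} := hs
      rw [h1] at this
      exact absurd this (Set.notMem_empty u)
    · refine ⟨_, ?_, rfl⟩
      have : b ∈ {e | Sum.inr (Sum.inl (t, e)) ∈ X} := hs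
      rcases h2 t with h | h
      · rw [h] at this
        exact absurd this (Set.notMem_empty b)
      · exact Set.eq_univ_iff_forall.mp h (!b)
    · exact ⟨_, hs, rfl⟩
  · intro hX
    refine ⟨fun t => ?_, fun t => ?_, fun t => ?_⟩
    · refine Set.eq_empty_iff_forall_notMem.mpr fun u hu => ?_
      obtain ⟨_, -, h⟩ := hX _ hu
      cases h
    · rw [or_iff_not_imp_left, ← Ne, ← Set.nonempty_iff_ne_empty]
      rintro ⟨b, hb⟩
      refine Set.eq_univ_of_forall fun b' => ?_
      rcases eq_or_ne b' b with rfl | hne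
      · exact hb
      · obtain ⟨_, hs, h⟩ := hX _ hb
        cases h
        rwa [← Bool.eq_not.mpr hne] at hs
    · rw [or_iff_not_imp_left, ← Ne, ← Set.nonempty_iff_ne_empty]
      rintro ⟨u, hu⟩
      exact Set.eq_univ_of_forall fun u' => hu

theorem exists_matching_of_isIsomorphic_canonical {E : Type*} [Fintype E] {i j k : ℕ}
    {D : SetSystem E} (hD : D.IsIsomorphic (canonical i j k)) :
    ∃ C : Matrix E E (ZMod 2), C.IsSymm ∧ (∀ e, C.IsMatchingRow e) ∧ ofMatrix C = D := by
  classical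
  obtain ⟨g, hg⟩ := hD
  let C : Matrix E E (ZMod 2) := Matrix.of fun e f =>
    if canonicalPartner (g e) = some (g f) then 1 else 0
  have hC : ∀ e f, C e f ≠ 0 ↔ canonicalPartner (g e) = some (g f) := by
    intro e f
    simp [C]
  have hsymm : ∀ s t : (Fin i × Unit) ⊕ ((Fin j × Bool) ⊕ (Fin k × Unit)),
      canonicalPartner s = some t → canonicalPartner t = some s := by
    rintro (s | ⟨s, b⟩ | s) t h <;> cases h
    · simp [canonicalPartner]
    · rfl
  have hCs : C.IsSymm := by
    ext e f
    have : canonicalPartner (g f) = some (g e) ↔ canonicalPartner (g e) = some (g f) :=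
      ⟨hsymm _ _, hsymm _ _⟩
    simp only [C, Matrix.transpose_apply, Matrix.of_apply, this]
  have hCm : ∀ e, C.IsMatchingRow e := by
    intro e f f' hf hf'
    rw [hC] at hf hf'
    exact g.injective (Option.some.inj (hf.symm.trans hf'))
  refine ⟨C, hCs, hCm, ?_⟩
  ext X
  rw [mem_ofMatrix_iff_of_isMatchingRow hCs hCm, hg, mem_canonical_iff]
  simp only [Set.forall_mem_image, Set.exists_mem_image, hC]

end SetSystem

/-! ### Translation between slides of matrices and of set systems -/

theorem Matrix.SlideConn.exists_isHandleSlideSeq {E : Type*} [Fintype E] [DecidableEq E]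
    {A C : Matrix E E (ZMod 2)} (hA : A.IsGraphic) (h : Matrix.SlideConn A C) :
    ∃ (n : ℕ) (S : ℕ → SetSystem E),
      SetSystem.IsHandleSlideSeq (SetSystem.ofMatrix A) (SetSystem.ofMatrix C) n S ∧
        ∀ t ≤ n, (S t).IsRibbonGraphic := by
  induction h with
  | refl =>
    exact ⟨0, fun _ => SetSystem.ofMatrix A, ⟨rfl, rfl, fun t ht => absurd ht (Nat.not_lt_zero t)⟩,
      fun _ _ => SetSystem.isRibbonGraphic_ofMatrix hA⟩
  | @tail B C _ hs ih =>
    obtain ⟨hB, hC, a, b, hab, rfl⟩ := hs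
    obtain ⟨n, S, ⟨h0, hn, hS⟩, hr⟩ := ih
    refine ⟨n + 1, fun t => if t ≤ n then S t else SetSystem.ofMatrix (B.slide a b),
      ⟨by simpa using h0, by simp, fun t ht => ?_⟩, fun t ht => ?_⟩
    · rcases Nat.lt_succ_iff_lt_or_eq.mp ht with h | rfl
      · simp only [if_pos h.le, if_pos (Nat.succ_le_of_lt h)]
        exact hS t h
      · refine ⟨a, b, hab, ?_⟩
        simp only [le_refl, if_true, if_neg (Nat.not_succ_le_self _)]
        rw [hn, SetSystem.ofMatrix_slide hB.1 hab]
    · dsimp only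
      split_ifs with h
      · exact hr t h
      · exact SetSystem.isRibbonGraphic_ofMatrix hC

/-- The handle slides lift step by step to congruences of symmetric matrices; the intermediate set
systems need not be ribbon graphic. -/
theorem SetSystem.IsHandleSlideSeq.exists_slideEquiv {E : Type*} [Fintype E] [DecidableEq E]
    {A : Matrix E E (ZMod 2)} (hA : A.IsSymm) {D' : SetSystem E} {n : ℕ} {S : ℕ → SetSystem E}
    (h : SetSystem.IsHandleSlideSeq (SetSystem.ofMatrix A) D' n S) :
    ∃ B : Matrix E E (ZMod 2), Matrix.SlideEquiv A B ∧ SetSystem.ofMatrix B = D' := by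
  obtain ⟨h0, rfl, hS⟩ := h
  induction n with
  | zero => exact ⟨A, .refl, h0.symm⟩
  | succ n ih =>
    obtain ⟨B, hAB, hB⟩ := ih fun t ht => hS t (ht.trans (Nat.lt_succ_self n))
    obtain ⟨a, b, hab, hab'⟩ := hS n (Nat.lt_succ_self n)
    refine ⟨B.slide a b, hAB.tail ⟨a, b, hab, rfl⟩, ?_⟩
    rw [SetSystem.ofMatrix_slide (hAB.isSymm hA) hab, hB, hab']

theorem corollaryc1 {E : Type*} [Finite E] (D : SetSystem E)
    (hD : D.IsRibbonGraphic) (hempty : ∅ ∈ D.feasible)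
    (i j k : ℕ) (D' : SetSystem E) (hD' : D'.IsIsomorphic (SetSystem.canonical i j k))
    (hslide : ∃ (n : ℕ) (S : ℕ → SetSystem E), SetSystem.IsHandleSlideSeq D D' n S) :
    ∃ (n : ℕ) (S : ℕ → SetSystem E), SetSystem.IsHandleSlideSeq D D' n S ∧
      ∀ t ≤ n, (S t).IsRibbonGraphic := by
  classical
  have := Fintype.ofFinite E
  obtain ⟨A, hA, rfl⟩ := SetSystem.exists_isGraphic hD hempty
  obtain ⟨C, hC, hCm, rfl⟩ := SetSystem.exists_matching_of_isIsomorphic_canonical hD'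
  obtain ⟨n, S, hS⟩ := hslide
  obtain ⟨B, hAB, hB⟩ := hS.exists_slideEquiv hA.1
  -- The matrix reached by lifting the given sequence and the matched matrix of the canonical form
  -- represent the same set system, so they coincide.
  obtain rfl := SetSystem.ofMatrix_injective (hAB.isSymm hA.1) hC hB
  exact (hA.slideConn hCm hAB).exists_isHandleSlideSeq hA
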